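/- Assume $\mathsf{CH}$. Let $l,n\in\omega$ with $l>0$, let $\kappa>\omega_l$ be a regular cardinal, and fix a well-order $\trianglelefteq$ of $\mathsf H(\kappa)$, the set of all sets whose transitive closure has size less than $\kappa$. Let $\mathsf{Sub}(\kappa)$ be the collection of all countable $M\subseteq\mathsf H(\kappa)$ such that $(M,\in,\trianglelefteq)$ is an elementary submodel of $(\mathsf H(\kappa),\in,\trianglelefteq)$, and put $\delta_M=M\cap\omega_1$ for $M\in\mathsf{Sub}(\kappa)$. A $0$-model is an element of $\mathsf{Sub}(\kappa)$. An $(m+1)$-model is an $N\in\mathsf{Sub}(\kappa)$ for which there is a sequence $\langle N_\alpha\mid\alpha<\delta_N\rangle$ of elements of $N$ such that each $N_\alpha$ is an $m$-model, $N_\alpha\in N_\beta$ whenever $\alpha<\beta<\delta_N$, $N_\alpha=\bigcup_{\xi<\alpha}N_\xi$ for every limit ordinal $\alpha<\delta_N$, and $N=\bigcup_{\alpha<\delta_N}N_\alpha$. Let $M_0,\dots,M_n\in\mathsf{Sub}(\kappa)$ with $\delta_{M_i}\le\delta_{M_{i+1}}$ for each $i<n$, and for each $i\le n$ let $A_i\in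 M_i$ be a countable subset of $\omega_l$. Let $N$ be an $l$-model with $\delta_{M_n}<\delta_N$ and let $X\in N$. Then there are $L\in N$ and sets $A_i(0),A_i(1)$ for $i\le n$ such that: 1. $L\in\mathsf{Sub}(\kappa)$, $\delta_{M_n}<\delta_L$ and $X\in L$; and, for every $i\le n$, 2. $\{A_i(0),A_i(1)\}\in M_i$, $A_i(0)\cap A_i(1)=\emptyset$ and $A_i(0)\cup A_i(1)=A_i$ (either part may be empty); 3. $A_i(0)\in L$ and $A_i(1)\cap L=\emptyset$. -/

import Mathlib

open scoped Cardinal Ordinal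

universe u

namespace CountableSubmodels

/-- The transitive closure of `x`: the least transitive set that includes `x`
(carved out of the transitive set `V_ (rank x)`, which includes `x`; see `mem_trcl`). -/
noncomputable def trcl (x : ZFSet.{u}) : ZFSet.{u} :=
  ZFSet.sep (fun y => ∀ t : ZFSet.{u}, t.IsTransitive → x ⊆ t → y ∈ t)
    (ZFSet.vonNeumann x.rank)

theorem mem_trcl {x y : ZFSet.{u}} :
    y ∈ trcl x ↔ ∀ t : ZFSet.{u}, t.IsTransitive → x ⊆ t → y ∈ t := by
  unfold trcl
  rw [ZFSet.mem_sep]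
  exact ⟨fun h => h.2, fun h => ⟨h _ (ZFSet.isTransitive_vonNeumann _)
    (ZFSet.subset_vonNeumann_self x), h⟩⟩

theorem isTransitive_trcl (x : ZFSet.{u}) : (trcl x).IsTransitive := by
  intro y hy z hz
  rw [mem_trcl] at hy ⊢
  exact fun t ht hxt => ht y (hy t ht hxt) hz

theorem subset_trcl (x : ZFSet.{u}) : x ⊆ trcl x := by
  intro y hy
  rw [mem_trcl]
  exact fun t _ hxt => hxt hy

/-- `H(κ)`: the sets whose transitive closure has fewer than `κ` elements. -/
def H (κ : Cardinal.{u}) : Set ZFSet.{u} :=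
  {x | (trcl x).card < κ}

/-- The two binary relation symbols: membership and the well-order. -/
inductive SetRel : ℕ → Type
  | mem : SetRel 2
  | wo : SetRel 2

/-- The first-order language with the two binary relation symbols `SetRel`. -/
def setLanguage : FirstOrder.Language :=
  ⟨fun _ => Empty, SetRel⟩

/-- The structure `(H(κ), ∈, ◁)`. -/
abbrev hStructure (κ : Cardinal.{u}) (r : H κ → H κ → Prop) : setLanguage.Structure (H κ) where
  funMap := fun f => f.elim
  RelMap := fun R =>
    match R with
    | .mem => fun v => (v 0 : ZFSet.{u}) ∈ (v 1 : ZFSet.{u})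
    | .wo => fun v => r (v 0) (v 1)

/-- `Sub(κ)`: the countable sets `M ⊆ H(κ)` for which `(M, ∈, ◁)` is an elementary submodel
of `(H(κ), ∈, ◁)`. -/
def Sub (κ : Cardinal.{u}) (r : H κ → H κ → Prop) : Set ZFSet.{u} :=
  {M | M.card ≤ ℵ₀ ∧
    ∃ S : @FirstOrder.Language.ElementarySubstructure setLanguage (H κ) (hStructure κ r),
      ∀ x : ZFSet.{u}, x ∈ M ↔ ∃ h : x ∈ H κ, (⟨x, h⟩ : H κ) ∈ S}

/-- The height `δ_M = M ∩ ω₁`. It is a von Neumann ordinal for `M ∈ Sub(κ)`, so that heights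
are compared through `⊆` (for `≤`) and `∈` (for `<`). -/
noncomputable def height (M : ZFSet.{u}) : ZFSet.{u} :=
  M ∩ (ω₁ : Ordinal.{u}).toZFSet

/-- `C` (restricted to the elements of the von Neumann ordinal `δ`) is a continuous increasing
chain of elements of `Sub(κ)`. -/
def IsContinuousIncreasingChain (κ : Cardinal.{u}) (r : H κ → H κ → Prop) (δ : ZFSet.{u})
    (C : Ordinal.{u} → ZFSet.{u}) : Prop :=
  (∀ α : Ordinal.{u}, α.toZFSet ∈ δ → C α ∈ Sub κ r) ∧
  (∀ α β : Ordinal.{u}, β.toZFSet ∈ δ → α < β → C α ∈ C β) ∧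
  (∀ α : Ordinal.{u}, α.toZFSet ∈ δ → Order.IsSuccLimit α →
    ∀ x : ZFSet.{u}, x ∈ C α ↔ ∃ ξ < α, x ∈ C ξ)

/-- `IsNModel κ r n N` says that `N` is an `n`-model. -/
def IsNModel (κ : Cardinal.{u}) (r : H κ → H κ → Prop) : ℕ → ZFSet.{u} → Prop
  | 0, N => N ∈ Sub κ r
  | n + 1, N => N ∈ Sub κ r ∧ ∃ C : Ordinal.{u} → ZFSet.{u},
      IsContinuousIncreasingChain κ r (height N) C ∧
      (∀ α : Ordinal.{u}, α.toZFSet ∈ height N → C α ∈ N) ∧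
      (∀ x : ZFSet.{u}, x ∈ N ↔ ∃ α : Ordinal.{u}, α.toZFSet ∈ height N ∧ x ∈ C α) ∧
      (∀ α : Ordinal.{u}, α.toZFSet ∈ height N → IsNModel κ r n (C α))

/-- `⟨M 0, …, M n⟩` is a `δ`-increasing sequence of elements of `Sub(κ)`. -/
def IsDeltaIncreasing (κ : Cardinal.{u}) (r : H κ → H κ → Prop) {n : ℕ}
    (M : Fin (n + 1) → ZFSet.{u}) : Prop :=
  (∀ i, M i ∈ Sub κ r) ∧ ∀ i : Fin n, height (M i.castSucc) ⊆ height (M i.succ)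

end CountableSubmodels

/-!
The sets `A i ∩ L` and `A i \ L` are the only candidates for the two parts, so the task is to find
`L ∈ N` in `Sub(κ)`, containing prescribed elements of `N`, such that `A i ∩ L` lies in both `M i`
and `L` for every `i`. This is `exists_sub_inter_mem`, proved by induction on `l` for all finite
families at once.

For `l = 1` any member `L` of the chain of `N` that contains the prescribed elements and the height
of `M n` will do. By `CH` the bounded subsets of `ω₁` are enumerated in order type `ω₁`, the
`◁`-least enumeration belongs to all elementary submodels, and the index of `A i` is an ordinal of
`M i`, hence of `L`. So `A i ∈ L`, and `A i ⊆ L` since `A i` is countable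
(`mem_of_countable_subset_omega_one`).

For the step from `l` to `l + 1`, let `⟨C α | α < δ⟩` be the chain of `N`. The order type of `A i`
is bounded by an ordinal of `M i`, hence is less than `δ`, and `δ` is closed under ordinal
multiplication. So the increasing traces `A i ∩ C α` cannot have their suprema grow everywhere:
there are `α < ε < δ` with `ε` a limit such that no element of `A i ∩ C ε` lies above `A i ∩ C α`,
for all `i` simultaneously (`exists_interval_const`, `IsModelChain.exists_stable`). The least
strict upper bound `γ i` of `A i ∩ C α` belongs to `M i`, because initial segments of the countable
set `A i` are cut off by elements of `A i`, and to `C ε`, because `ε` is a limit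
(`IsModelChain.rank_inter_mem`). As `γ i < ω_{l+1}`, the `◁`-least injection `e i` of `γ i` into
`ω_l` belongs to `M i` and to every elementary submodel that contains `γ i`. The induction
hypothesis, applied to the `l`-model `C ε` and the images under `e i` of `A i ∩ γ i`, provides an
`L ∈ C ε` with all `γ i ∈ L`, and `A i ∩ L` is the preimage under `e i` of the trace of that image
on `L`, because `A i ∩ C ε ⊆ γ i`.

Elementarity is used through the class `IsFirstOrder` of relations that are definable over `(H(κ),
∈, ◁)` without parameters. Its instances recognize a relation written with bounded quantifiers, or
with quantifiers over `H(κ)`, as first-order, and the Tarski–Vaught property (`exists_mem_of_sub`)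
then places witnesses inside the submodels.
-/

namespace CountableSubmodels

open FirstOrder Language

variable {κ : Cardinal.{u}} {r : H κ → H κ → Prop}

/-! ### First-order relations over `H(κ)` -/

/-- A relation between sets is first-order over `(H(κ), ∈, ◁)` if some formula without parameters
defines its restriction to `H(κ)`. Relations are given on valuations `Γ → ZFSet` of a type `Γ` of
variables. -/
class IsFirstOrder (κ : Cardinal.{u}) (r : H κ → H κ → Prop) {Γ : Type}
    (P : (Γ → ZFSet.{u}) → Prop) : Prop where
  exists_formula : ∃ φ : setLanguage.Formula Γ, ∀ v : Γ → H κ,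
    @Formula.Realize setLanguage (H κ) (hStructure κ r) Γ φ v ↔ P (fun i => v i)

/-- The well-order `◁` as a relation between sets. -/
def WO (r : H κ → H κ → Prop) (x y : ZFSet.{u}) : Prop :=
  ∃ (hx : x ∈ H κ) (hy : y ∈ H κ), r ⟨x, hx⟩ ⟨y, hy⟩

namespace IsFirstOrder

variable {Γ : Type}

instance mem (i j : Γ) : IsFirstOrder κ r (fun v => v i ∈ v j) := by
  let _ := hStructure κ r
  refine ⟨⟨Relations.formula (L := setLanguage) (n := 2) SetRel.mem ![.var i, .var j], fun v => ?_⟩⟩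
  exact Formula.realize_rel.trans Iff.rfl

instance wo (i j : Γ) : IsFirstOrder κ r (fun v => WO r (v i) (v j)) := by
  let _ := hStructure κ r
  refine ⟨⟨Relations.formula (L := setLanguage) (n := 2) SetRel.wo ![.var i, .var j], fun v => ?_⟩⟩
  exact Formula.realize_rel.trans
    ⟨fun h => ⟨(v i).2, (v j).2, h⟩, fun ⟨_, _, h⟩ => h⟩

instance eq (i j : Γ) : IsFirstOrder κ r (fun v => v i = v j) := by
  let _ := hStructure κ r
  refine ⟨⟨Term.equal (L := setLanguage) (.var i) (.var j), fun v => ?_⟩⟩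
  rw [Formula.realize_equal]
  exact Subtype.ext_iff

instance false : IsFirstOrder κ r (fun _ : Γ → ZFSet.{u} => False) := by
  let _ := hStructure κ r
  exact ⟨⟨⊥, fun v => Formula.realize_bot⟩⟩

instance imp {P Q : (Γ → ZFSet.{u}) → Prop} [hP : IsFirstOrder κ r P] [hQ : IsFirstOrder κ r Q] :
    IsFirstOrder κ r (fun v => P v → Q v) := by
  let _ := hStructure κ r
  obtain ⟨φ, hφ⟩ := hP
  obtain ⟨ψ, hψ⟩ := hQ
  exact ⟨⟨φ.imp ψ, fun v => by rw [Formula.realize_imp, hφ, hψ]⟩⟩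

instance not {P : (Γ → ZFSet.{u}) → Prop} [hP : IsFirstOrder κ r P] :
    IsFirstOrder κ r (fun v => ¬ P v) :=
  inferInstanceAs (IsFirstOrder κ r (fun v => P v → False))

instance and {P Q : (Γ → ZFSet.{u}) → Prop} [hP : IsFirstOrder κ r P] [hQ : IsFirstOrder κ r Q] :
    IsFirstOrder κ r (fun v => P v ∧ Q v) := by
  let _ := hStructure κ r
  obtain ⟨φ, hφ⟩ := hP
  obtain ⟨ψ, hψ⟩ := hQ
  exact ⟨⟨φ ⊓ ψ, fun v => by rw [Formula.realize_inf, hφ, hψ]⟩⟩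

instance or {P Q : (Γ → ZFSet.{u}) → Prop} [hP : IsFirstOrder κ r P] [hQ : IsFirstOrder κ r Q] :
    IsFirstOrder κ r (fun v => P v ∨ Q v) := by
  let _ := hStructure κ r
  obtain ⟨φ, hφ⟩ := hP
  obtain ⟨ψ, hψ⟩ := hQ
  exact ⟨⟨φ ⊔ ψ, fun v => by rw [Formula.realize_sup, hφ, hψ]⟩⟩

instance iff {P Q : (Γ → ZFSet.{u}) → Prop} [hP : IsFirstOrder κ r P] [hQ : IsFirstOrder κ r Q] :
    IsFirstOrder κ r (fun v => (P v ↔ Q v)) := by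
  let _ := hStructure κ r
  obtain ⟨φ, hφ⟩ := hP
  obtain ⟨ψ, hψ⟩ := hQ
  exact ⟨⟨φ.iff ψ, fun v => by rw [Formula.realize_iff, hφ, hψ]⟩⟩

instance existsH {P : (Γ → ZFSet.{u}) → ZFSet.{u} → Prop}
    [hP : IsFirstOrder κ r
      (fun w : Γ ⊕ Unit → ZFSet.{u} => P (fun i => w (.inl i)) (w (.inr ())))] :
    IsFirstOrder κ r (fun v => ∃ x ∈ H κ, P v x) := by
  let _ := hStructure κ r
  obtain ⟨φ, hφ⟩ := hP
  refine ⟨⟨φ.iExs Unit, fun v => ?_⟩⟩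
  rw [Formula.realize_iExs]
  simp only [hφ, Sum.elim_inl, Sum.elim_inr]
  exact ⟨fun ⟨f, h⟩ => ⟨_, (f ()).2, h⟩, fun ⟨x, hx, h⟩ => ⟨fun _ => ⟨x, hx⟩, h⟩⟩

instance forallH {P : (Γ → ZFSet.{u}) → ZFSet.{u} → Prop}
    [hP : IsFirstOrder κ r
      (fun w : Γ ⊕ Unit → ZFSet.{u} => P (fun i => w (.inl i)) (w (.inr ())))] :
    IsFirstOrder κ r (fun v => ∀ x ∈ H κ, P v x) := by
  let _ := hStructure κ r
  obtain ⟨φ, hφ⟩ := hP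
  refine ⟨⟨φ.iAlls Unit, fun v => ?_⟩⟩
  rw [Formula.realize_iAlls]
  simp only [hφ, Sum.elim_inl, Sum.elim_inr]
  exact ⟨fun h x hx => h fun _ => ⟨x, hx⟩, fun h f => h _ (f ()).2⟩

/-- First-orderness depends only on the restriction of a relation to `H(κ)`. -/
theorem congr {P Q : (Γ → ZFSet.{u}) → Prop} (hP : IsFirstOrder κ r P)
    (h : ∀ v : Γ → ZFSet.{u}, (∀ i, v i ∈ H κ) → (P v ↔ Q v)) : IsFirstOrder κ r Q := by
  obtain ⟨φ, hφ⟩ := hP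
  exact ⟨⟨φ, fun v => by rw [hφ, h _ fun i => (v i).2]⟩⟩

end IsFirstOrder

/-! ### The set `H(κ)` -/

theorem mem_H_of_mem {x y : ZFSet.{u}} (hx : x ∈ H κ) (hy : y ∈ x) : y ∈ H κ := by
  refine lt_of_le_of_lt (ZFSet.card_mono fun z hz => ?_) hx
  rw [mem_trcl] at hz
  exact hz _ (isTransitive_trcl x) (isTransitive_trcl x _ (subset_trcl x hy))

theorem card_lt_of_mem_H {x : ZFSet.{u}} (hx : x ∈ H κ) : x.card < κ :=
  (ZFSet.card_mono (subset_trcl x)).trans_lt hx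

/-- For regular `κ`, a set of fewer than `κ` elements of `H(κ)` is an element of `H(κ)`. -/
theorem mem_H_of_forall_mem (hκ : κ.IsRegular) {x : ZFSet.{u}} (hx : ∀ y ∈ x, y ∈ H κ)
    (hc : x.card < κ) : x ∈ H κ := by
  let t : ZFSet.{u} :=
    x ∪ ZFSet.iUnion fun y : Shrink.{u} x => trcl ((equivShrink x).symm y : ZFSet.{u})
  have mem_t : ∀ z, z ∈ t ↔ z ∈ x ∨ ∃ y ∈ x, z ∈ trcl y := by
    intro z
    simp only [t, ZFSet.mem_union, ZFSet.mem_iUnion]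
    refine or_congr Iff.rfl ⟨fun ⟨y, hy⟩ => ⟨_, ((equivShrink x).symm y).2, hy⟩, fun ⟨y, hy, hz⟩ =>
      ⟨equivShrink x ⟨y, hy⟩, by simpa using hz⟩⟩
  have htr : t.IsTransitive := by
    intro y hy z hz
    rw [mem_t] at hy ⊢
    rcases hy with hy | ⟨w, hw, hy⟩
    · exact Or.inr ⟨y, hy, subset_trcl y hz⟩
    · exact Or.inr ⟨w, hw, isTransitive_trcl w y hy hz⟩
  have hsub : trcl x ⊆ t := fun z hz => by
    rw [mem_trcl] at hz
    exact hz t htr fun y hy => (mem_t y).2 (Or.inl hy)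
  refine (ZFSet.card_mono hsub).trans_lt (ZFSet.card_union_le.trans_lt ?_)
  refine Cardinal.add_lt_of_lt hκ.aleph0_le hc ?_
  have := ZFSet.lift_card_iUnion_le_sum_card.{u,u}
    (f := fun y : Shrink.{u} x => trcl ((equivShrink x).symm y : ZFSet.{u}))
  rw [Cardinal.lift_id] at this
  refine this.trans_lt (Cardinal.sum_lt_of_isRegular hκ hc fun y => ?_)
  exact hx _ ((equivShrink x).symm y).2

theorem mem_H_of_subset {x y : ZFSet.{u}} (hκ : κ.IsRegular) (hx : x ∈ H κ) (hy : y ⊆ x) :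
    y ∈ H κ :=
  mem_H_of_forall_mem hκ (fun _ hz => mem_H_of_mem hx (hy hz))
    ((ZFSet.card_mono hy).trans_lt (card_lt_of_mem_H hx))

theorem insert_mem_H {x y : ZFSet.{u}} (hκ : κ.IsRegular) (hx : x ∈ H κ) (hy : y ∈ H κ) :
    insert x y ∈ H κ := by
  refine mem_H_of_forall_mem hκ (fun z hz => ?_) (ZFSet.card_insert_le.trans_lt ?_)
  · rcases ZFSet.mem_insert_iff.1 hz with rfl | h
    exacts [hx, mem_H_of_mem hy h]
  · exact Cardinal.add_lt_of_lt hκ.aleph0_le (card_lt_of_mem_H hy)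
      (Cardinal.one_lt_aleph0.trans_le hκ.aleph0_le)

theorem empty_mem_H (hκ : κ.IsRegular) : (∅ : ZFSet.{u}) ∈ H κ :=
  mem_H_of_forall_mem hκ (fun _ h => (ZFSet.notMem_empty _ h).elim) (by simpa using hκ.pos)

theorem pairSet_mem_H {x y : ZFSet.{u}} (hκ : κ.IsRegular) (hx : x ∈ H κ) (hy : y ∈ H κ) :
    ({x, y} : ZFSet.{u}) ∈ H κ :=
  insert_mem_H hκ hx (by simpa using insert_mem_H hκ hy (empty_mem_H hκ))

theorem singleton_mem_H {x : ZFSet.{u}} (hκ : κ.IsRegular) (hx : x ∈ H κ) :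
    ({x} : ZFSet.{u}) ∈ H κ := by
  simpa using insert_mem_H hκ hx (empty_mem_H hκ)

theorem pair_mem_H {x y : ZFSet.{u}} (hκ : κ.IsRegular) (hx : x ∈ H κ) (hy : y ∈ H κ) :
    ZFSet.pair x y ∈ H κ :=
  pairSet_mem_H hκ (singleton_mem_H hκ hx) (pairSet_mem_H hκ hx hy)

theorem mem_H_of_pair {x y : ZFSet.{u}} (h : ZFSet.pair x y ∈ H κ) : x ∈ H κ ∧ y ∈ H κ := by
  have h2 : ({x, y} : ZFSet.{u}) ∈ H κ := mem_H_of_mem h (by simp [ZFSet.pair])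
  exact ⟨mem_H_of_mem h2 (by simp), mem_H_of_mem h2 (by simp)⟩

theorem toZFSet_mem_H (hκ : κ.IsRegular) {α : Ordinal.{u}} (hα : α.card < κ) : α.toZFSet ∈ H κ := by
  induction α using WellFoundedLT.induction with
  | ind α ih =>
    refine mem_H_of_forall_mem hκ (fun y hy => ?_) (by simpa using hα)
    obtain ⟨β, hβ, rfl⟩ := Ordinal.mem_toZFSet_iff.1 hy
    exact ih β hβ ((Ordinal.card_le_card hβ.le).trans_lt hα)

/-! ### Further first-order relations -/

namespace IsFirstOrder

variable {Γ : Type}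

instance existsMem {j : Γ} {P : (Γ → ZFSet.{u}) → ZFSet.{u} → Prop}
    [hP : IsFirstOrder κ r
      (fun w : Γ ⊕ Unit → ZFSet.{u} => P (fun i => w (.inl i)) (w (.inr ())))] :
    IsFirstOrder κ r (fun v => ∃ x ∈ v j, P v x) :=
  congr (P := fun v => ∃ x ∈ H κ, x ∈ v j ∧ P v x) inferInstance fun _ hv =>
    ⟨fun ⟨x, _, h⟩ => ⟨x, h⟩, fun ⟨x, h⟩ => ⟨x, mem_H_of_mem (hv j) h.1, h⟩⟩

instance forallMem {j : Γ} {P : (Γ → ZFSet.{u}) → ZFSet.{u} → Prop}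
    [hP : IsFirstOrder κ r
      (fun w : Γ ⊕ Unit → ZFSet.{u} => P (fun i => w (.inl i)) (w (.inr ())))] :
    IsFirstOrder κ r (fun v => ∀ x ∈ v j, P v x) :=
  congr (P := fun v => ∀ x ∈ H κ, x ∈ v j → P v x) inferInstance fun _ hv =>
    ⟨fun h x hx => h x (mem_H_of_mem (hv j) hx) hx, fun h x _ hx => h x hx⟩

instance subset (i j : Γ) : IsFirstOrder κ r (fun v => v i ⊆ v j) :=
  congr (P := fun v => ∀ x ∈ v i, x ∈ v j) inferInstance fun _ _ => Iff.rfl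

instance isOrdinal (i : Γ) : IsFirstOrder κ r (fun v => (v i).IsOrdinal) :=
  congr (P := fun v => (∀ y ∈ v i, y ⊆ v i) ∧ ∀ y ∈ v i, ∀ z ∈ y, z ⊆ y) inferInstance fun _ _ =>
    ZFSet.isOrdinal_iff_forall_mem_isTransitive.symm

-- Kuratowski pairs: `v i` has the elements `{v j}` and `{v j, v k}`, and no others.
instance eqPair (i j k : Γ) : IsFirstOrder κ r (fun v => v i = ZFSet.pair (v j) (v k)) := by
  refine congr (P := fun v => (∃ a ∈ v i, v j ∈ a ∧ ∀ x ∈ a, x = v j) ∧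
    (∃ a ∈ v i, v j ∈ a ∧ v k ∈ a ∧ ∀ x ∈ a, x = v j ∨ x = v k) ∧
    (∀ a ∈ v i, (v j ∈ a ∧ ∀ x ∈ a, x = v j) ∨
      v j ∈ a ∧ v k ∈ a ∧ ∀ x ∈ a, x = v j ∨ x = v k)) inferInstance fun v _ => ?_
  have h1 : ∀ a, (v j ∈ a ∧ ∀ x ∈ a, x = v j) ↔ a = {v j} := fun a =>
    ⟨fun h => ZFSet.ext fun z => by
      rw [ZFSet.mem_singleton]; exact ⟨h.2 z, fun e => e ▸ h.1⟩, by rintro rfl; simp⟩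
  have h2 : ∀ a, (v j ∈ a ∧ v k ∈ a ∧ ∀ x ∈ a, x = v j ∨ x = v k) ↔ a = {v j, v k} := fun a =>
    ⟨fun h => ZFSet.ext fun z => by
      rw [ZFSet.mem_pair]
      exact ⟨h.2.2 z, fun e => e.elim (fun e => e ▸ h.1) fun e => e ▸ h.2.1⟩, by rintro rfl; simp⟩
  simp only [h1, h2]
  constructor
  · rintro ⟨⟨a, ha, rfl⟩, ⟨b, hb, rfl⟩, h⟩
    ext z
    simp only [ZFSet.pair, ZFSet.mem_pair]
    exact ⟨h z, fun e => e.elim (fun e => e ▸ ha) fun e => e ▸ hb⟩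
  · intro h
    rw [h]
    simp [ZFSet.pair]

instance pairMem (i j k : Γ) : IsFirstOrder κ r (fun v => ZFSet.pair (v i) (v j) ∈ v k) :=
  congr (P := fun v => ∃ p ∈ v k, p = ZFSet.pair (v i) (v j)) inferInstance fun _ _ => by simp

end IsFirstOrder

/-! ### Closure properties of elementary submodels -/

theorem IsFirstOrder.relabel {Γ Δ : Type} {P : (Γ → ZFSet.{u}) → Prop} (hP : IsFirstOrder κ r P)
    (g : Γ → Δ) : IsFirstOrder κ r (fun w : Δ → ZFSet.{u} => P (fun i => w (g i))) := by
  let _ := hStructure κ r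
  obtain ⟨φ, hφ⟩ := hP
  exact ⟨⟨φ.relabel g, fun v => by rw [Formula.realize_relabel, hφ]; rfl⟩⟩

theorem mem_H_of_mem_sub {M x : ZFSet.{u}} (hM : M ∈ Sub κ r) (hx : x ∈ M) : x ∈ H κ := by
  obtain ⟨-, S, hS⟩ := hM
  exact ((hS x).1 hx).1

/-- The Tarski–Vaught property of an elementary submodel, for first-order relations. -/
theorem exists_mem_of_sub {M : ZFSet.{u}} (hM : M ∈ Sub κ r) {Γ : Type}
    {P : (Γ → ZFSet.{u}) → ZFSet.{u} → Prop}
    [hP : IsFirstOrder κ r (fun w : Γ ⊕ Unit → ZFSet.{u} => P (fun i => w (.inl i)) (w (.inr ())))]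
    (v : Γ → ZFSet.{u}) (hv : ∀ i, v i ∈ M) (h : ∃ x ∈ H κ, P v x) : ∃ x ∈ M, P v x := by
  let _ := hStructure κ r
  obtain ⟨-, S, hS⟩ := hM
  have hv' : ∀ i, ∃ h : v i ∈ H κ, (⟨v i, h⟩ : H κ) ∈ S := fun i => (hS _).1 (hv i)
  let v' : Γ → S := fun i => ⟨⟨v i, (hv' i).1⟩, (hv' i).2⟩
  obtain ⟨φ, hφ⟩ := hP
  have h1 : (φ.iExs Unit).Realize (S.subtype ∘ v') := by
    obtain ⟨x, hx, hPx⟩ := h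
    rw [Formula.realize_iExs]
    exact ⟨fun _ => ⟨x, hx⟩, (hφ _).2 hPx⟩
  rw [S.subtype.map_formula, Formula.realize_iExs] at h1
  obtain ⟨f, hf⟩ := h1
  rw [← S.subtype.map_formula, hφ] at hf
  exact ⟨((f ()).1 : H κ), (hS _).2 ⟨(f ()).1.2, (f ()).2⟩, hf⟩

section ThreeParameters

variable {M : ZFSet.{u}}

theorem exists_mem_of_sub₃ (hM : M ∈ Sub κ r) (a b c : ZFSet.{u})
    (P : ZFSet.{u} → ZFSet.{u} → ZFSet.{u} → ZFSet.{u} → Prop)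
    [hP : IsFirstOrder κ r (fun w : Fin 3 ⊕ Unit → ZFSet.{u} =>
      P (w (.inl 0)) (w (.inl 1)) (w (.inl 2)) (w (.inr ())))]
    (ha : a ∈ M) (hb : b ∈ M) (hc : c ∈ M) (h : ∃ x ∈ H κ, P a b c x) : ∃ x ∈ M, P a b c x :=
  exists_mem_of_sub (Γ := Fin 3) (P := fun v x => P (v 0) (v 1) (v 2) x) hM ![a, b, c]
    (by simp [Fin.forall_fin_succ, ha, hb, hc]) h

/-- An element of `H(κ)` that is uniquely determined by a first-order relation to elements of an
elementary submodel belongs to that submodel. -/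
theorem mem_of_sub_of_unique (hM : M ∈ Sub κ r) (a b c : ZFSet.{u})
    (P : ZFSet.{u} → ZFSet.{u} → ZFSet.{u} → ZFSet.{u} → Prop)
    [hP : IsFirstOrder κ r (fun w : Fin 3 ⊕ Unit → ZFSet.{u} =>
      P (w (.inl 0)) (w (.inl 1)) (w (.inl 2)) (w (.inr ())))]
    (ha : a ∈ M) (hb : b ∈ M) (hc : c ∈ M) {x : ZFSet.{u}} (hx : x ∈ H κ) (hPx : P a b c x)
    (huniq : ∀ y ∈ H κ, P a b c y → y = x) : x ∈ M := by
  obtain ⟨y, hy, hPy⟩ := exists_mem_of_sub₃ hM a b c P ha hb hc ⟨x, hx, hPx⟩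
  rwa [← huniq y (mem_H_of_mem_sub hM hy) hPy]

/-- An element of `H(κ)` whose elements are those in a first-order relation to elements of an
elementary submodel belongs to that submodel. -/
theorem mem_of_sub_of_ext (hM : M ∈ Sub κ r) (a b c : ZFSet.{u})
    (Q : ZFSet.{u} → ZFSet.{u} → ZFSet.{u} → ZFSet.{u} → Prop)
    [hQ : IsFirstOrder κ r (fun w : Fin 3 ⊕ Unit → ZFSet.{u} =>
      Q (w (.inl 0)) (w (.inl 1)) (w (.inl 2)) (w (.inr ())))]
    (ha : a ∈ M) (hb : b ∈ M) (hc : c ∈ M) {x : ZFSet.{u}} (hx : x ∈ H κ)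
    (hQx : ∀ y ∈ H κ, y ∈ x ↔ Q a b c y) : x ∈ M := by
  have := hQ.relabel (Sum.elim (fun i => Sum.inl (Sum.inl i)) Sum.inr :
    Fin 3 ⊕ Unit → (Fin 3 ⊕ Unit) ⊕ Unit)
  refine mem_of_sub_of_unique hM a b c (fun a b c x => ∀ y ∈ H κ, y ∈ x ↔ Q a b c y)
    (hP := @IsFirstOrder.forallH _ _ _ (fun (v : Fin 3 ⊕ Unit → ZFSet.{u}) y => y ∈ v (.inr ()) ↔
      Q (v (.inl 0)) (v (.inl 1)) (v (.inl 2)) y) (@IsFirstOrder.iff _ _ _ _ _ inferInstance this))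
    ha hb hc hx hQx fun z hz hQz => ZFSet.ext fun y => ?_
  exact ⟨fun h => (hQx y (mem_H_of_mem hz h)).2 ((hQz y (mem_H_of_mem hz h)).1 h),
    fun h => (hQz y (mem_H_of_mem hx h)).2 ((hQx y (mem_H_of_mem hx h)).1 h)⟩

/-- Among the witnesses of a first-order property of `a`, `b`, `c`, the `◁`-least one lies in every
elementary submodel that contains the parameters. -/
theorem exists_canonical (hr : IsWellOrder (H κ) r) (a b c : ZFSet.{u})
    (P : ZFSet.{u} → ZFSet.{u} → ZFSet.{u} → ZFSet.{u} → Prop)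
    [hP : IsFirstOrder κ r (fun w : Fin 3 ⊕ Unit → ZFSet.{u} =>
      P (w (.inl 0)) (w (.inl 1)) (w (.inl 2)) (w (.inr ())))]
    (h : ∃ x ∈ H κ, P a b c x) :
    ∃ x ∈ H κ, P a b c x ∧ ∀ M ∈ Sub κ r, a ∈ M → b ∈ M → c ∈ M → x ∈ M := by
  obtain ⟨x, hx, hPx⟩ := h
  obtain ⟨⟨m, hm⟩, hPm, hmin⟩ := hr.wf.has_min {y : H κ | P a b c y} ⟨⟨x, hx⟩, hPx⟩
  refine ⟨m, hm, hPm, fun M hM ha hb hc => ?_⟩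
  have := hP.relabel (Sum.elim (fun i => Sum.inl (Sum.inl i)) Sum.inr :
    Fin 3 ⊕ Unit → (Fin 3 ⊕ Unit) ⊕ Unit)
  refine mem_of_sub_of_unique hM a b c
    (fun a b c x => P a b c x ∧ ∀ y ∈ H κ, P a b c y → ¬ WO r y x)
    (hP := @IsFirstOrder.and _ _ _ _ _ hP (@IsFirstOrder.forallH _ _ _
      (fun (v : Fin 3 ⊕ Unit → ZFSet.{u}) y =>
        P (v (.inl 0)) (v (.inl 1)) (v (.inl 2)) y → ¬ WO r y (v (.inr ())))
      (@IsFirstOrder.imp _ _ _ _ _ this inferInstance)))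
    ha hb hc hm ⟨hPm, fun y hy hPy h => hmin ⟨y, hy⟩ hPy ?_⟩ fun z hz ⟨hPz, hzmin⟩ => ?_
  · obtain ⟨_, _, h⟩ := h
    exact h
  · have h1 : ¬ r ⟨z, hz⟩ ⟨m, hm⟩ := hmin ⟨z, hz⟩ hPz
    have h2 : ¬ r ⟨m, hm⟩ ⟨z, hz⟩ := fun h => hzmin m hm hPm ⟨hm, hz, h⟩
    exact congrArg Subtype.val (hr.trichotomous _ _ h1 h2)

end ThreeParameters

/-! ### Graphs of functions -/

theorem range_mem_H (hκ : κ.IsRegular) {ι : Type u} (hι : #ι < κ) {f : ι → ZFSet.{u}}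
    (hf : ∀ i, f i ∈ H κ) : ZFSet.range f ∈ H κ := by
  refine mem_H_of_forall_mem hκ (fun y hy => ?_) ?_
  · obtain ⟨i, rfl⟩ := ZFSet.mem_range.1 hy
    exact hf i
  · have := ZFSet.lift_card_range_le.{u, u} (f := f)
    rw [Cardinal.lift_id, Cardinal.lift_id] at this
    exact this.trans_lt hι

/-- The graph of `F`, restricted to the set `x`. -/
noncomputable def graph (x : ZFSet.{u}) (F : ZFSet.{u} → ZFSet.{u}) : ZFSet.{u} :=
  ZFSet.range fun a : Shrink.{u} x =>
    ZFSet.pair ((equivShrink x).symm a) (F ((equivShrink x).symm a))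

theorem pair_mem_graph {x a b : ZFSet.{u}} {F : ZFSet.{u} → ZFSet.{u}} :
    ZFSet.pair a b ∈ graph x F ↔ a ∈ x ∧ b = F a := by
  unfold graph
  rw [ZFSet.mem_range]
  constructor
  · rintro ⟨i, h⟩
    obtain ⟨rfl, rfl⟩ := ZFSet.pair_inj.1 h
    exact ⟨((equivShrink x).symm i).2, rfl⟩
  · rintro ⟨ha, rfl⟩
    exact ⟨equivShrink x ⟨a, ha⟩, by simp⟩

theorem graph_mem_H (hκ : κ.IsRegular) {x : ZFSet.{u}} (hx : x ∈ H κ) {F : ZFSet.{u} → ZFSet.{u}}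
    (hF : ∀ a ∈ x, F a ∈ H κ) : graph x F ∈ H κ :=
  range_mem_H hκ (card_lt_of_mem_H hx) fun i =>
    pair_mem_H hκ (mem_H_of_mem hx ((equivShrink x).symm i).2) (hF _ ((equivShrink x).symm i).2)

/-- `f ∩ (x × y)` is the graph of an injection from `x` to `y`. -/
def IsInjection (f x y : ZFSet.{u}) : Prop :=
  (∀ a ∈ x, ∃ b ∈ y, ZFSet.pair a b ∈ f) ∧
  (∀ a ∈ x, ∀ a' ∈ x, ∀ b ∈ y, ZFSet.pair a b ∈ f → ZFSet.pair a' b ∈ f → a = a') ∧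
  (∀ a ∈ x, ∀ b ∈ y, ∀ b' ∈ y, ZFSet.pair a b ∈ f → ZFSet.pair a b' ∈ f → b = b')

instance {Γ : Type} (i j k : Γ) : IsFirstOrder κ r (fun v => IsInjection (v i) (v j) (v k)) := by
  unfold IsInjection
  infer_instance

theorem card_le_of_forall_exists {x y : ZFSet.{u}} (R : ZFSet.{u} → ZFSet.{u} → Prop)
    (h : ∀ a ∈ x, ∃ b ∈ y, R a b)
    (hinj : ∀ a ∈ x, ∀ a' ∈ x, ∀ b ∈ y, R a b → R a' b → a = a') : x.card ≤ y.card := by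
  choose g hg hgR using h
  rw [← Cardinal.lift_le.{u + 1}, ← ZFSet.cardinalMk_coe_sort, ← ZFSet.cardinalMk_coe_sort]
  refine Cardinal.mk_le_of_injective (f := fun a : x => (⟨g a.1 a.2, hg _ _⟩ : y)) fun a b hab => ?_
  have hab' : g a.1 a.2 = g b.1 b.2 := congrArg Subtype.val hab
  exact Subtype.ext (hinj a a.2 b b.2 _ (hg _ _) (hgR _ _) (by rw [hab']; exact hgR _ _))

theorem card_le_of_isInjection {f x y : ZFSet.{u}} (h : IsInjection f x y) : x.card ≤ y.card :=
  card_le_of_forall_exists _ h.1 h.2.1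

theorem exists_isInjection (hκ : κ.IsRegular) {x y : ZFSet.{u}} (hx : x ∈ H κ) (hy : y ∈ H κ)
    (h : x.card ≤ y.card) : ∃ f ∈ H κ, IsInjection f x y := by
  classical
  obtain ⟨e⟩ := h
  let F : ZFSet.{u} → ZFSet.{u} := fun a =>
    if h : a ∈ x then (equivShrink y).symm (e (equivShrink x ⟨a, h⟩)) else ∅
  have hF : ∀ a ∈ x, F a ∈ y := fun a ha => by
    simp only [F, dif_pos ha]
    exact ((equivShrink y).symm _).2
  refine ⟨graph x F, graph_mem_H hκ hx fun a ha => mem_H_of_mem hy (hF a ha), ?_, ?_, ?_⟩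
  · exact fun a ha => ⟨F a, hF a ha, pair_mem_graph.2 ⟨ha, rfl⟩⟩
  · intro a ha a' ha' b _ h1 h2
    have h3 := (pair_mem_graph.1 h1).2.symm.trans (pair_mem_graph.1 h2).2
    simp only [F, dif_pos ha, dif_pos ha'] at h3
    simpa using e.injective ((equivShrink y).symm.injective (Subtype.ext h3))
  · intro a _ b _ b' _ h1 h2
    rw [(pair_mem_graph.1 h1).2, (pair_mem_graph.1 h2).2]

/-! ### Sets that belong to elementary submodels -/

section Closure

variable {M : ZFSet.{u}}

theorem empty_mem_sub (hκ : κ.IsRegular) (hM : M ∈ Sub κ r) : (∅ : ZFSet.{u}) ∈ M := by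
  obtain ⟨x, hx, h⟩ := exists_mem_of_sub hM (Γ := Empty) (P := fun _ x => ∀ y ∈ x, False)
    (fun i => i.elim) (fun i => i.elim) ⟨∅, empty_mem_H hκ, fun y hy => ZFSet.notMem_empty y hy⟩
  rwa [(ZFSet.eq_empty x).2 h] at hx

theorem insert_mem_sub (hκ : κ.IsRegular) (hM : M ∈ Sub κ r) {a b : ZFSet.{u}} (ha : a ∈ M)
    (hb : b ∈ M) : insert a b ∈ M :=
  mem_of_sub_of_ext hM a b b (fun a b _ y => y = a ∨ y ∈ b) ha hb hb
    (insert_mem_H hκ (mem_H_of_mem_sub hM ha) (mem_H_of_mem_sub hM hb))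
    (by simp [ZFSet.mem_insert_iff])

theorem pairSet_mem_sub (hκ : κ.IsRegular) (hM : M ∈ Sub κ r) {a b : ZFSet.{u}} (ha : a ∈ M)
    (hb : b ∈ M) : ({a, b} : ZFSet.{u}) ∈ M :=
  insert_mem_sub hκ hM ha (by simpa using insert_mem_sub hκ hM hb (empty_mem_sub hκ hM))

theorem inter_mem_sub (hκ : κ.IsRegular) (hM : M ∈ Sub κ r) {a b : ZFSet.{u}} (ha : a ∈ M)
    (hb : b ∈ M) : a ∩ b ∈ M :=
  mem_of_sub_of_ext hM a b b (fun a b _ y => y ∈ a ∧ y ∈ b) ha hb hb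
    (mem_H_of_subset hκ (mem_H_of_mem_sub hM ha) fun _ h => (ZFSet.mem_inter.1 h).1)
    (by simp)

theorem sdiff_mem_sub (hκ : κ.IsRegular) (hM : M ∈ Sub κ r) {a b : ZFSet.{u}} (ha : a ∈ M)
    (hb : b ∈ M) : a \ b ∈ M :=
  mem_of_sub_of_ext hM a b b (fun a b _ y => y ∈ a ∧ y ∉ b) ha hb hb
    (mem_H_of_subset hκ (mem_H_of_mem_sub hM ha) fun _ h => (ZFSet.mem_sdiff.1 h).1)
    (by simp)

theorem natCast_mem_sub (hκ : κ.IsRegular) (hM : M ∈ Sub κ r) (n : ℕ) :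
    (n : Ordinal.{u}).toZFSet ∈ M := by
  induction n with
  | zero => simpa using empty_mem_sub hκ hM
  | succ n ih => simpa using insert_mem_sub hκ hM ih ih

theorem mem_toZFSet_omega0 {x : ZFSet.{u}} :
    x ∈ (ω : Ordinal.{u}).toZFSet ↔ ∃ n : ℕ, (n : Ordinal.{u}).toZFSet = x := by
  rw [Ordinal.mem_toZFSet_iff]
  constructor
  · rintro ⟨a, ha, rfl⟩
    obtain ⟨n, rfl⟩ := Ordinal.lt_omega0.1 ha
    exact ⟨n, rfl⟩
  · rintro ⟨n, rfl⟩
    exact ⟨n, Ordinal.natCast_lt_omega0 n, rfl⟩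

theorem omega0_mem_H (hκ : κ.IsRegular) (hκ₀ : ℵ₀ < κ) : (ω : Ordinal.{u}).toZFSet ∈ H κ :=
  toZFSet_mem_H hκ (by simpa using hκ₀)

/-- `ω` is definable as the least set that contains `∅` and is closed under successors. -/
theorem omega0_mem_sub (hκ : κ.IsRegular) (hκ₀ : ℵ₀ < κ) (hM : M ∈ Sub κ r) :
    (ω : Ordinal.{u}).toZFSet ∈ M := by
  have he := empty_mem_sub hκ hM
  have key : ∀ x, (∅ ∈ x ∧ ∀ y ∈ x, ∃ z ∈ x, ∀ t ∈ H κ, t ∈ z ↔ (t = y ∨ t ∈ y)) →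
      x ∈ H κ → (ω : Ordinal.{u}).toZFSet ⊆ x := by
    rintro x ⟨h0, h1⟩ hx y hy
    obtain ⟨n, rfl⟩ := mem_toZFSet_omega0.1 hy
    clear hy
    induction n with
    | zero => simpa using h0
    | succ n ih =>
      obtain ⟨z, hz, h⟩ := h1 _ ih
      suffices z = ((n + 1 : ℕ) : Ordinal.{u}).toZFSet from this ▸ hz
      ext t
      simp only [Nat.cast_add, Nat.cast_one, Ordinal.toZFSet_add_one, ZFSet.mem_insert_iff]
      refine ⟨fun ht => (h t (mem_H_of_mem (mem_H_of_mem hx hz) ht)).1 ht, fun ht => (h t ?_).2 ht⟩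
      rcases ht with rfl | ht
      exacts [mem_H_of_mem hx ih, mem_H_of_mem (mem_H_of_mem hx ih) ht]
  have hω : ∅ ∈ (ω : Ordinal.{u}).toZFSet ∧ ∀ y ∈ (ω : Ordinal.{u}).toZFSet,
      ∃ z ∈ (ω : Ordinal.{u}).toZFSet, ∀ t ∈ H κ, t ∈ z ↔ (t = y ∨ t ∈ y) := by
    refine ⟨mem_toZFSet_omega0.2 ⟨0, by simp⟩, fun y hy => ?_⟩
    obtain ⟨n, rfl⟩ := mem_toZFSet_omega0.1 hy
    exact ⟨_, mem_toZFSet_omega0.2 ⟨n + 1, rfl⟩, fun t _ => by simp [ZFSet.mem_insert_iff]⟩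
  refine mem_of_sub_of_unique hM ∅ ∅ ∅ (fun e _ _ x =>
    (e ∈ x ∧ ∀ y ∈ x, ∃ z ∈ x, ∀ t ∈ H κ, t ∈ z ↔ (t = y ∨ t ∈ y)) ∧
    ∀ x' ∈ H κ, (e ∈ x' ∧ ∀ y ∈ x', ∃ z ∈ x', ∀ t ∈ H κ, t ∈ z ↔ (t = y ∨ t ∈ y)) → x ⊆ x')
    he he he (omega0_mem_H hκ hκ₀) ⟨hω, fun x' hx' h => key x' h hx'⟩ fun y hy hPy => ?_
  exact subset_antisymm (hPy.2 _ (omega0_mem_H hκ hκ₀) hω) (key y hPy.1 hy)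

/-- A countable element of an elementary submodel is a subset of it. -/
theorem subset_of_mem_sub (hκ : κ.IsRegular) (hκ₀ : ℵ₀ < κ) (hM : M ∈ Sub κ r) {x : ZFSet.{u}}
    (hx : x ∈ M) (hc : x.card ≤ ℵ₀) : x ⊆ M := by
  have hxH := mem_H_of_mem_sub hM hx
  have hω := omega0_mem_sub hκ hκ₀ hM
  obtain ⟨f, hfM, hf⟩ := exists_mem_of_sub₃ hM x _ _ (fun x w _ f => IsInjection f x w) hx hω hω
    (exists_isInjection hκ hxH (omega0_mem_H hκ hκ₀) (by simpa using hc))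
  intro a ha
  obtain ⟨b, hb, hab⟩ := hf.1 a ha
  have hbM : b ∈ M := by
    obtain ⟨n, rfl⟩ := mem_toZFSet_omega0.1 hb
    exact natCast_mem_sub hκ hM n
  exact mem_of_sub_of_unique hM f b x (fun f b x a => a ∈ x ∧ ZFSet.pair a b ∈ f) hfM hbM hx
    (mem_H_of_mem hxH ha) ⟨ha, hab⟩ fun y _ hy => hf.2.1 y hy.1 a ha b hb hy.2 hab

theorem sub_subset_of_mem_sub (hκ : κ.IsRegular) (hκ₀ : ℵ₀ < κ) (hM : M ∈ Sub κ r)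
    {L : ZFSet.{u}} (hL : L ∈ Sub κ r) (hLM : L ∈ M) : L ⊆ M :=
  subset_of_mem_sub hκ hκ₀ hM hLM hL.1

theorem omega_mem_H (hκ : κ.IsRegular) {k : ℕ} (hk : ℵ_ (k : Ordinal.{u}) < κ) :
    (ω_ (k : Ordinal.{u})).toZFSet ∈ H κ :=
  toZFSet_mem_H hκ (by simpa using hk)

theorem aleph0_lt_of_aleph_nat_lt {k : ℕ} (hk : ℵ_ (k : Ordinal.{u}) < κ) : ℵ₀ < κ :=
  (Cardinal.aleph0_le_aleph _).trans_lt hk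

/-- `ω_{k+1}` is definable from `ω_k` as the set of all ordinals that inject into `ω_k`. -/
theorem omega_mem_sub (hκ : κ.IsRegular) {k : ℕ} (hk : ℵ_ (k : Ordinal.{u}) < κ)
    (hM : M ∈ Sub κ r) : (ω_ (k : Ordinal.{u})).toZFSet ∈ M := by
  induction k with
  | zero => simpa using omega0_mem_sub hκ (aleph0_lt_of_aleph_nat_lt hk) hM
  | succ k ih =>
    have hk' : ℵ_ (k : Ordinal.{u}) < κ :=
      lt_of_le_of_lt (Cardinal.aleph_le_aleph.2 (by simp)) hk
    have hw := ih hk'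
    refine mem_of_sub_of_ext hM _ _ _
      (fun w _ _ y => y.IsOrdinal ∧ ∃ f ∈ H κ, IsInjection f y w) hw hw hw (omega_mem_H hκ hk)
      fun y hy => ⟨fun h => ?_, fun ⟨h1, f, _, h2⟩ => ?_⟩
    · obtain ⟨α, hα, rfl⟩ := Ordinal.mem_toZFSet_iff.1 h
      refine ⟨ZFSet.isOrdinal_toZFSet α, exists_isInjection hκ hy (omega_mem_H hκ hk') ?_⟩
      have h3 : α.card < ℵ_ ((k : Ordinal.{u}) + 1) := by
        rw [← Cardinal.lt_ord]
        simpa using hα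
      rw [← Cardinal.succ_aleph, Order.lt_succ_iff] at h3
      simpa using h3
    · obtain ⟨α, rfl⟩ := ZFSet.isOrdinal_iff_mem_range_toZFSet.1 h1
      have h3 := card_le_of_isInjection h2
      rw [Ordinal.toZFSet_mem_toZFSet_iff, ← Cardinal.ord_aleph, Cardinal.lt_ord]
      push_cast
      rw [← Cardinal.succ_aleph, Order.lt_succ_iff]
      simpa using h3

end Closure

/-! ### Sets of ordinals -/

section SetsOfOrdinals

variable {A : ZFSet.{u}} {α : Ordinal.{u}}

theorem isOrdinal_of_mem_of_subset (hA : A ⊆ α.toZFSet) {a : ZFSet.{u}} (ha : a ∈ A) :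
    a.IsOrdinal :=
  (ZFSet.isOrdinal_toZFSet α).mem (hA ha)

/-- For a set `A` of ordinals, `A.rank` is the least strict upper bound of `A`. -/
theorem mem_toZFSet_rank_iff (hA : ∀ a ∈ A, a.IsOrdinal) {y : ZFSet.{u}} :
    y ∈ A.rank.toZFSet ↔ ∃ b ∈ A, y = b ∨ y ∈ b := by
  rw [Ordinal.mem_toZFSet_iff]
  constructor
  · rintro ⟨β, hβ, rfl⟩
    obtain ⟨b, hb, hle⟩ := ZFSet.lt_rank_iff.1 hβ
    refine ⟨b, hb, ?_⟩
    rw [← (hA b hb).toZFSet_rank_eq]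
    rcases hle.eq_or_lt with h | h
    · exact Or.inl (by rw [← h])
    · exact Or.inr (Ordinal.toZFSet_mem_toZFSet_iff.2 h)
  · rintro ⟨b, hb, h⟩
    have hy : y.IsOrdinal := by
      rcases h with rfl | h
      exacts [hA _ hb, (hA _ hb).mem h]
    refine ⟨y.rank, lt_of_le_of_lt ?_ (ZFSet.rank_lt_of_mem hb), hy.toZFSet_rank_eq⟩
    rcases h with rfl | h
    exacts [le_rfl, (ZFSet.rank_lt_of_mem h).le]

theorem subset_toZFSet_rank (hA : ∀ a ∈ A, a.IsOrdinal) : A ⊆ A.rank.toZFSet :=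
  fun a ha => (mem_toZFSet_rank_iff hA).2 ⟨a, ha, Or.inl rfl⟩

theorem rank_le_of_subset_toZFSet (hA : A ⊆ α.toZFSet) : A.rank ≤ α := by
  simpa using ZFSet.rank_mono hA

/-- A countable subset of `ω_{k+1}` is bounded. -/
theorem rank_lt_omega_succ {k : ℕ} (hA : A ⊆ (ω_ ((k + 1 : ℕ) : Ordinal.{u})).toZFSet)
    (hc : A.card ≤ ℵ₀) : A.rank < ω_ ((k + 1 : ℕ) : Ordinal.{u}) := by
  have hreg : (ℵ_ ((k + 1 : ℕ) : Ordinal.{u})).IsRegular := by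
    push_cast
    exact Cardinal.isRegular_aleph_add_one _
  have hlt : A.card < (ω_ ((k + 1 : ℕ) : Ordinal.{u})).cof := by
    rw [hreg.cof_omega_eq]
    refine hc.trans_lt ?_
    rw [← Cardinal.aleph_zero, Cardinal.aleph_lt_aleph]
    exact_mod_cast Nat.succ_pos k
  have h2 := Ordinal.iSup_add_one_lt_of_lt_cof
    (f := fun a : Shrink.{u} A => ((equivShrink A).symm a : ZFSet.{u}).rank) hlt fun a => by
      have h1 := hA ((equivShrink A).symm a).2
      simpa using ZFSet.rank_lt_of_mem h1
  refine lt_of_le_of_lt (ZFSet.rank_le_iff.2 fun a ha => ?_) h2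
  rw [← Order.add_one_le_iff]
  have h3 := Ordinal.le_iSup
    (fun a : Shrink.{u} A => ((equivShrink A).symm a : ZFSet.{u}).rank + 1) (equivShrink A ⟨a, ha⟩)
  simpa using h3

/-- A countable set of ordinals has a countable order type. -/
theorem exists_strictMono_to_countable (hA : ∀ a ∈ A, a.IsOrdinal) (hc : A.card ≤ ℵ₀) :
    ∃ θ < ω_ 1, ∃ F : ZFSet.{u} → ZFSet.{u}, (∀ a ∈ A, F a ∈ θ.toZFSet) ∧
      ∀ a ∈ A, ∀ b ∈ A, a ∈ b → F a ∈ F b := by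
  classical
  let s : Shrink.{u} A → Shrink.{u} A → Prop := fun x y =>
    ((equivShrink A).symm x : ZFSet.{u}) ∈ ((equivShrink A).symm y : ZFSet.{u})
  have : IsWellOrder _ s :=
    { wf := InvImage.wf (fun x => ((equivShrink A).symm x : ZFSet.{u})) ZFSet.mem_wf
      trichotomous := fun x y h1 h2 => by
        rcases (hA _ ((equivShrink A).symm x).2).mem_trichotomous
          (hA _ ((equivShrink A).symm y).2) with h | h | h
        exacts [(h1 h).elim, (equivShrink A).symm.injective (Subtype.ext h), (h2 h).elim] }
  refine ⟨Ordinal.type s, ?_, fun a => if h : a ∈ A then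
    (Ordinal.typein s (equivShrink A ⟨a, h⟩)).toZFSet else ∅, fun a ha => ?_,
    fun a ha b hb hab => ?_⟩
  · rw [← Cardinal.ord_aleph, Cardinal.lt_ord, Ordinal.card_type]
    exact lt_of_le_of_lt hc Cardinal.aleph0_lt_aleph_one
  · simp only [dif_pos ha, Ordinal.toZFSet_mem_toZFSet_iff]
    exact Ordinal.typein_lt_type s _
  · simp only [dif_pos ha, dif_pos hb, Ordinal.toZFSet_mem_toZFSet_iff]
    rw [Ordinal.typein_lt_typein]
    simpa [s] using hab

end SetsOfOrdinals

/-! ### Countable ordinals in elementary submodels -/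

section Heights

variable {M : ZFSet.{u}}

theorem toZFSet_mem_height {α : Ordinal.{u}} :
    α.toZFSet ∈ height M ↔ α.toZFSet ∈ M ∧ α < ω_ 1 := by
  simp [height]

theorem card_toZFSet_le_aleph0 {α : Ordinal.{u}} (hα : α < ω_ 1) : α.toZFSet.card ≤ ℵ₀ := by
  rw [← Cardinal.ord_aleph, Cardinal.lt_ord, ← zero_add (1 : Ordinal.{u}), ← Cardinal.succ_aleph,
    Order.lt_succ_iff] at hα
  simpa using hα

theorem omega_one_mem_sub (hκ : κ.IsRegular) (hκ₁ : ℵ₁ < κ) (hM : M ∈ Sub κ r) :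
    (ω_ (1 : Ordinal.{u})).toZFSet ∈ M := by
  simpa using omega_mem_sub (k := 1) hκ (by simpa using hκ₁) hM

theorem toZFSet_mem_H_of_lt_omega_one (hκ : κ.IsRegular) (hκ₁ : ℵ₁ < κ) {α : Ordinal.{u}}
    (hα : α < ω_ 1) : α.toZFSet ∈ H κ :=
  toZFSet_mem_H hκ ((by simpa using card_toZFSet_le_aleph0 hα : α.card ≤ ℵ₀).trans_lt
    (Cardinal.aleph0_lt_aleph_one.trans hκ₁))

/-- `f` relates every pair in `a × b` to an element of `c`, in a strictly increasing way with
respect to the lexicographic order in which the first coordinate dominates. For ordinals `α`, `β`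
that product has order type `β * α`. -/
def IsLexMap (f a b c : ZFSet.{u}) : Prop :=
  (∀ x ∈ a, ∀ y ∈ b, ∃ z ∈ c, ZFSet.pair (ZFSet.pair x y) z ∈ f) ∧
  ∀ x ∈ a, ∀ y ∈ b, ∀ x' ∈ a, ∀ y' ∈ b, ∀ z ∈ c, ∀ z' ∈ c,
    ZFSet.pair (ZFSet.pair x y) z ∈ f → ZFSet.pair (ZFSet.pair x' y') z' ∈ f →
    (x ∈ x' ∨ x = x' ∧ y ∈ y') → z ∈ z'

instance {Γ : Type} (i j k l : Γ) :
    IsFirstOrder κ r (fun v => ZFSet.pair (ZFSet.pair (v i) (v j)) (v k) ∈ v l) :=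
  IsFirstOrder.congr
    (P := fun v => ∃ q ∈ H κ, q = ZFSet.pair (v i) (v j) ∧ ZFSet.pair q (v k) ∈ v l)
    inferInstance fun v hv =>
      ⟨by rintro ⟨q, _, rfl, h⟩; exact h,
        fun h => ⟨_, (mem_H_of_pair (mem_H_of_mem (hv l) h)).1, rfl, h⟩⟩

instance {Γ : Type} (i j k l : Γ) :
    IsFirstOrder κ r (fun v => IsLexMap (v i) (v j) (v k) (v l)) := by
  unfold IsLexMap
  infer_instance

theorem exists_isLexMap (hκ : κ.IsRegular) (hκ₁ : ℵ₁ < κ) {α β : Ordinal.{u}} (hα : α < ω_ 1)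
    (hβ : β < ω_ 1) : ∃ f ∈ H κ, IsLexMap f α.toZFSet β.toZFSet (β * α).toZFSet := by
  have hαβ : β * α < ω_ 1 := Ordinal.isPrincipal_mul_omega 1 hβ hα
  have hH : ∀ {γ : Ordinal.{u}}, γ < ω_ 1 → γ.toZFSet ∈ H κ :=
    toZFSet_mem_H_of_lt_omega_one hκ hκ₁
  have hlt : ∀ {x y : Ordinal.{u}}, x < α → y < β → β * x + y < β * α := fun {x y} hx hy =>
    calc β * x + y < β * x + β := by gcongr
      _ = β * (x + 1) := by rw [mul_add, mul_one]
      _ ≤ β * α := by gcongr; exact Order.add_one_le_of_lt hx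
  refine ⟨ZFSet.range fun p : α.ToType × β.ToType => ZFSet.pair
    (ZFSet.pair (Ordinal.ToType.mk.symm p.1).1.toZFSet (Ordinal.ToType.mk.symm p.2).1.toZFSet)
    (β * (Ordinal.ToType.mk.symm p.1).1 + (Ordinal.ToType.mk.symm p.2).1).toZFSet,
    range_mem_H hκ ?_ fun p => ?_, ?_⟩
  · rw [Cardinal.mk_prod, Cardinal.lift_id, Cardinal.lift_id, Cardinal.mk_toType, Cardinal.mk_toType]
    refine lt_of_le_of_lt ?_ (Cardinal.aleph0_lt_aleph_one.trans hκ₁)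
    refine (mul_le_mul' ?_ ?_).trans Cardinal.aleph0_mul_aleph0.le
    · simpa using card_toZFSet_le_aleph0 hα
    · simpa using card_toZFSet_le_aleph0 hβ
  · have h1 := (Ordinal.ToType.mk.symm p.1).2
    have h2 := (Ordinal.ToType.mk.symm p.2).2
    exact pair_mem_H hκ (pair_mem_H hκ (hH (lt_trans h1 hα)) (hH (lt_trans h2 hβ)))
      (hH ((hlt h1 h2).trans hαβ))
  · have key : ∀ x y z : Ordinal.{u}, ZFSet.pair (ZFSet.pair x.toZFSet y.toZFSet) z.toZFSet ∈
        (ZFSet.range fun p : α.ToType × β.ToType => ZFSet.pair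
        (ZFSet.pair (Ordinal.ToType.mk.symm p.1).1.toZFSet (Ordinal.ToType.mk.symm p.2).1.toZFSet)
        (β * (Ordinal.ToType.mk.symm p.1).1 + (Ordinal.ToType.mk.symm p.2).1).toZFSet) ↔
        x < α ∧ y < β ∧ z = β * x + y := by
      intro x y z
      rw [ZFSet.mem_range]
      constructor
      · rintro ⟨p, hp⟩
        simp only [ZFSet.pair_inj, Ordinal.toZFSet_injective.eq_iff] at hp
        obtain ⟨⟨rfl, rfl⟩, rfl⟩ := hp
        exact ⟨(Ordinal.ToType.mk.symm p.1).2, (Ordinal.ToType.mk.symm p.2).2, rfl⟩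
      · rintro ⟨hx, hy, rfl⟩
        exact ⟨(Ordinal.ToType.mk ⟨x, hx⟩, Ordinal.ToType.mk ⟨y, hy⟩), by simp⟩
    constructor
    · intro x hx y hy
      obtain ⟨x, hx₁, rfl⟩ := Ordinal.mem_toZFSet_iff.1 hx
      obtain ⟨y, hy₁, rfl⟩ := Ordinal.mem_toZFSet_iff.1 hy
      exact ⟨_, Ordinal.toZFSet_mem_toZFSet_iff.2 (hlt hx₁ hy₁), (key _ _ _).2 ⟨hx₁, hy₁, rfl⟩⟩
    · intro x hx y hy x' hx' y' hy' z hz z' hz' h h' hlex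
      obtain ⟨x, hx, rfl⟩ := Ordinal.mem_toZFSet_iff.1 hx
      obtain ⟨y, hy, rfl⟩ := Ordinal.mem_toZFSet_iff.1 hy
      obtain ⟨x', hx', rfl⟩ := Ordinal.mem_toZFSet_iff.1 hx'
      obtain ⟨y', hy', rfl⟩ := Ordinal.mem_toZFSet_iff.1 hy'
      obtain ⟨z, hz, rfl⟩ := Ordinal.mem_toZFSet_iff.1 hz
      obtain ⟨z', hz', rfl⟩ := Ordinal.mem_toZFSet_iff.1 hz'
      obtain ⟨-, -, rfl⟩ := (key _ _ _).1 h
      obtain ⟨-, -, rfl⟩ := (key _ _ _).1 h'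
      simp only [Ordinal.toZFSet_mem_toZFSet_iff, Ordinal.toZFSet_injective.eq_iff] at hlex ⊢
      rcases hlex with hlex | ⟨rfl, hlex⟩
      · calc β * x + y < β * x + β := by gcongr
          _ = β * (x + 1) := by rw [mul_add, mul_one]
          _ ≤ β * x' := by gcongr; exact Order.add_one_le_of_lt hlex
          _ ≤ β * x' + y' := le_self_add
      · gcongr

-- An increasing map satisfies `η ≤ g η`; here it is composed with `η ↦ (η / β, η % β)`.
theorem mul_le_of_isLexMap {f : ZFSet.{u}} {α β γ : Ordinal.{u}}
    (h : IsLexMap f α.toZFSet β.toZFSet γ.toZFSet) : β * α ≤ γ := by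
  have h1 : ∀ x < α, ∀ y < β, ∃ z < γ,
      ZFSet.pair (ZFSet.pair x.toZFSet y.toZFSet) z.toZFSet ∈ f := by
    intro x hx y hy
    obtain ⟨z, hz, hf⟩ := h.1 _ (Ordinal.toZFSet_mem_toZFSet_iff.2 hx) _
      (Ordinal.toZFSet_mem_toZFSet_iff.2 hy)
    obtain ⟨z, hz₁, rfl⟩ := Ordinal.mem_toZFSet_iff.1 hz
    exact ⟨z, hz₁, hf⟩
  choose! g hg hgf using h1
  have hβ : ∀ η < β * α, β ≠ 0 := by
    rintro η hη rfl
    simp at hη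
  have hdiv : ∀ η < β * α, η / β < α := fun η hη => (Ordinal.lt_mul_iff_div_lt (hβ η hη)).1 hη
  have hmod : ∀ η < β * α, η % β < β := fun η hη => Ordinal.mod_lt _ (hβ η hη)
  have hmono : ∀ ζ η, ζ < η → η < β * α → g (ζ / β) (ζ % β) < g (η / β) (η % β) := by
    intro ζ η hζη hη
    have hζ := hζη.trans hη
    have h2 := h.2 _ (Ordinal.toZFSet_mem_toZFSet_iff.2 (hdiv ζ hζ)) _
      (Ordinal.toZFSet_mem_toZFSet_iff.2 (hmod ζ hζ)) _
      (Ordinal.toZFSet_mem_toZFSet_iff.2 (hdiv η hη)) _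
      (Ordinal.toZFSet_mem_toZFSet_iff.2 (hmod η hη)) _
      (Ordinal.toZFSet_mem_toZFSet_iff.2 (hg _ (hdiv ζ hζ) _ (hmod ζ hζ))) _
      (Ordinal.toZFSet_mem_toZFSet_iff.2 (hg _ (hdiv η hη) _ (hmod η hη)))
      (hgf _ (hdiv ζ hζ) _ (hmod ζ hζ)) (hgf _ (hdiv η hη) _ (hmod η hη))
    simp only [Ordinal.toZFSet_mem_toZFSet_iff, Ordinal.toZFSet_injective.eq_iff] at h2
    refine h2 ?_
    rcases lt_trichotomy (ζ / β) (η / β) with h3 | h3 | h3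
    · exact Or.inl h3
    · refine Or.inr ⟨h3, ?_⟩
      rw [← Ordinal.div_add_mod ζ β, ← Ordinal.div_add_mod η β, h3] at hζη
      exact lt_of_add_lt_add_left hζη
    · refine absurd hζη (not_lt.2 ?_)
      calc η = β * (η / β) + η % β := (Ordinal.div_add_mod η β).symm
        _ ≤ β * (η / β) + β := by gcongr; exact (hmod η hη).le
        _ = β * (η / β + 1) := by rw [mul_add, mul_one]
        _ ≤ β * (ζ / β) := by gcongr; exact Order.add_one_le_of_lt h3
        _ ≤ β * (ζ / β) + ζ % β := le_self_add
        _ = ζ := Ordinal.div_add_mod ζ β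
  have hle : ∀ η, η < β * α → η ≤ g (η / β) (η % β) := by
    intro η
    induction η using WellFoundedLT.induction with
    | ind η ih =>
      exact fun hη => le_of_forall_lt fun ζ hζ =>
        (ih ζ hζ (hζ.trans hη)).trans_lt (hmono ζ η hζ hη)
  exact le_of_forall_lt fun η hη => (hle η hη).trans_lt (hg _ (hdiv η hη) _ (hmod η hη))

theorem toZFSet_mem_sub_of_le (hκ : κ.IsRegular) (hκ₁ : ℵ₁ < κ) (hM : M ∈ Sub κ r)
    {α β : Ordinal.{u}} (hα : α.toZFSet ∈ M) (hα₁ : α < ω_ 1) (h : β ≤ α) : β.toZFSet ∈ M := by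
  rcases h.eq_or_lt with rfl | h
  · exact hα
  · exact subset_of_mem_sub hκ (Cardinal.aleph0_lt_aleph_one.trans hκ₁) hM hα
      (card_toZFSet_le_aleph0 hα₁) (Ordinal.toZFSet_mem_toZFSet_iff.2 h)

theorem mul_mem_sub (hκ : κ.IsRegular) (hκ₁ : ℵ₁ < κ) (hM : M ∈ Sub κ r)
    {α β : Ordinal.{u}} (hα : α.toZFSet ∈ M) (hα₁ : α < ω_ 1) (hβ : β.toZFSet ∈ M)
    (hβ₁ : β < ω_ 1) : (β * α).toZFSet ∈ M := by
  obtain ⟨c, hc, hc₁, f, -, hf⟩ := exists_mem_of_sub₃ hM _ _ _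
    (fun a b w c => c ∈ w ∧ ∃ f ∈ H κ, IsLexMap f a b c) hα hβ (omega_one_mem_sub hκ hκ₁ hM)
    ⟨(β * α).toZFSet,
      toZFSet_mem_H_of_lt_omega_one hκ hκ₁ (Ordinal.isPrincipal_mul_omega 1 hβ₁ hα₁),
      Ordinal.toZFSet_mem_toZFSet_iff.2 (Ordinal.isPrincipal_mul_omega 1 hβ₁ hα₁),
      exists_isLexMap hκ hκ₁ hα₁ hβ₁⟩
  obtain ⟨γ, hγ, rfl⟩ := Ordinal.mem_toZFSet_iff.1 hc₁
  exact toZFSet_mem_sub_of_le hκ hκ₁ hM hc hγ (mul_le_of_isLexMap hf)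

/-- The height of an elementary submodel is a countable ordinal above `ω` that is closed under
ordinal multiplication. -/
theorem exists_height_eq (hκ : κ.IsRegular) (hκ₁ : ℵ₁ < κ) (hM : M ∈ Sub κ r) :
    ∃ δ : Ordinal.{u}, height M = δ.toZFSet ∧ ω < δ ∧ Ordinal.IsPrincipal (· * ·) δ := by
  have hord : (height M).IsOrdinal := by
    rw [ZFSet.isOrdinal_iff_forall_mem_isOrdinal]
    refine ⟨fun x hx y hy => ?_, fun x hx => ?_⟩
    · have hx' : x.IsOrdinal := (ZFSet.isOrdinal_toZFSet _).mem (ZFSet.mem_inter.1 hx).2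
      obtain ⟨α, rfl⟩ := ZFSet.isOrdinal_iff_mem_range_toZFSet.1 hx'
      obtain ⟨β, hβ, rfl⟩ := Ordinal.mem_toZFSet_iff.1 hy
      rw [toZFSet_mem_height] at hx ⊢
      exact ⟨toZFSet_mem_sub_of_le hκ hκ₁ hM hx.1 hx.2 hβ.le, hβ.trans hx.2⟩
    · exact (ZFSet.isOrdinal_toZFSet _).mem (ZFSet.mem_inter.1 hx).2
  obtain ⟨δ, hδ⟩ := ZFSet.isOrdinal_iff_mem_range_toZFSet.1 hord
  have hmem : ∀ α : Ordinal.{u}, α < δ ↔ α.toZFSet ∈ M ∧ α < ω_ 1 := fun α => by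
    rw [← toZFSet_mem_height, ← hδ, Ordinal.toZFSet_mem_toZFSet_iff]
  refine ⟨δ, hδ.symm, (hmem _).2 ⟨?_, Ordinal.omega0_lt_omega_one⟩, fun α β hα hβ => ?_⟩
  · exact omega0_mem_sub hκ (Cardinal.aleph0_lt_aleph_one.trans hκ₁) hM
  · rw [hmem] at hα hβ ⊢
    exact ⟨mul_mem_sub hκ hκ₁ hM hβ.1 hβ.2 hα.1 hα.2, Ordinal.isPrincipal_mul_omega 1 hα.2 hβ.2⟩

/-- `f` relates every element of the set of ordinals `a` to an element of `c`, in a strictly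
increasing way. -/
def IsOrderMap (f a c : ZFSet.{u}) : Prop :=
  (∀ x ∈ a, ∃ z ∈ c, ZFSet.pair x z ∈ f) ∧
  ∀ x ∈ a, ∀ x' ∈ a, ∀ z ∈ c, ∀ z' ∈ c, ZFSet.pair x z ∈ f → ZFSet.pair x' z' ∈ f →
    x ∈ x' → z ∈ z'

instance {Γ : Type} (i j k : Γ) : IsFirstOrder κ r (fun v => IsOrderMap (v i) (v j) (v k)) := by
  unfold IsOrderMap
  infer_instance

/-- The order type of a countable set of ordinals that belongs to an elementary submodel is bounded
by a countable ordinal of that submodel. -/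
theorem exists_strictMono_of_mem_sub (hκ : κ.IsRegular) (hκ₁ : ℵ₁ < κ) (hM : M ∈ Sub κ r)
    {A : ZFSet.{u}} (hAM : A ∈ M) (hA : ∀ a ∈ A, a.IsOrdinal) (hc : A.card ≤ ℵ₀) :
    ∃ θ < ω_ 1, θ.toZFSet ∈ M ∧ ∃ F : ZFSet.{u} → Ordinal.{u}, (∀ a ∈ A, F a < θ) ∧
      ∀ a ∈ A, ∀ b ∈ A, a ∈ b → F a < F b := by
  have hw := omega_one_mem_sub hκ hκ₁ hM
  obtain ⟨c, hc, hc₁, f, -, hf⟩ := exists_mem_of_sub₃ hM _ _ _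
    (fun a w _ c => c ∈ w ∧ ∃ f ∈ H κ, IsOrderMap f a c) hAM hw hw (by
      obtain ⟨θ, hθ, F, hF, hFm⟩ := exists_strictMono_to_countable hA hc
      have hθH := toZFSet_mem_H_of_lt_omega_one hκ hκ₁ hθ
      refine ⟨θ.toZFSet, hθH, Ordinal.toZFSet_mem_toZFSet_iff.2 hθ, graph A F,
        graph_mem_H hκ (mem_H_of_mem_sub hM hAM) fun a ha => mem_H_of_mem hθH (hF a ha),
        fun x hx => ⟨F x, hF x hx, pair_mem_graph.2 ⟨hx, rfl⟩⟩,
        fun x hx x' hx' z _ z' _ h h' hxx' => ?_⟩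
      rw [(pair_mem_graph.1 h).2, (pair_mem_graph.1 h').2]
      exact hFm x hx x' hx' hxx')
  obtain ⟨θ, hθ, rfl⟩ := Ordinal.mem_toZFSet_iff.1 hc₁
  choose! F hF hFf using hf.1
  refine ⟨θ, hθ, hc, fun a => (F a).rank, fun a ha => ?_, fun a ha b hb hab => ?_⟩
  · simpa using ZFSet.rank_lt_of_mem (hF a ha)
  · exact ZFSet.rank_lt_of_mem
      (hf.2 a ha b hb _ (hF a ha) _ (hF b hb) (hFf a ha) (hFf b hb) hab)

end Heights

/-! ### Bounded monotone functions are constant on long intervals -/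

/-- If `δ` is closed under multiplication, finitely many monotone functions on `δ` that are bounded
below `δ` have a common interval of constancy of any prescribed length `μ < δ`. -/
theorem exists_interval_const {ι : Type*} {δ : Ordinal.{u}} (hδ : Ordinal.IsPrincipal (· * ·) δ)
    (hωδ : ω < δ) (g : ι → Ordinal.{u} → Ordinal.{u}) (θ : ι → Ordinal.{u})
    (hg : ∀ i, ∀ α β, α ≤ β → β < δ → g i α ≤ g i β) (hgθ : ∀ i, ∀ α < δ, g i α ≤ θ i)
    (hθ : ∀ i, θ i < δ) {α₀ : Ordinal.{u}} (hα₀ : α₀ < δ) (s : Finset ι) :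
    ∀ μ < δ, ∃ α, α₀ ≤ α ∧ α + μ < δ ∧ ∀ i ∈ s, g i α = g i (α + μ) := by
  classical
  have hadd : Ordinal.IsPrincipal (· + ·) δ := Ordinal.isPrincipal_add_of_isPrincipal_mul hδ
    ((by simpa using Ordinal.natCast_lt_omega0 2 : (2 : Ordinal.{u}) < ω).trans hωδ).ne'
  have h1δ : (1 : Ordinal.{u}) < δ := Ordinal.one_lt_omega0.trans hωδ
  induction s using Finset.induction with
  | empty => exact fun μ hμ => ⟨α₀, le_rfl, hadd hα₀ hμ, by simp⟩
  | insert i s _ ih =>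
    intro μ hμ
    -- Split an interval on which the other functions are constant into more than `θ i` pieces of
    -- length `μ`; then `g i` cannot increase on every piece.
    obtain ⟨α, hα, hαμ, hs⟩ := ih (μ * (θ i + 1)) (hδ hμ (hadd (hθ i) h1δ))
    have hle : ∀ ξ ≤ θ i + 1, α + μ * ξ ≤ α + μ * (θ i + 1) := fun ξ hξ => by gcongr
    have hex : ∃ ξ < θ i + 1, g i (α + μ * ξ) = g i (α + μ * (ξ + 1)) := by
      by_contra! hne
      have hlt : ∀ ξ < θ i + 1, g i (α + μ * ξ) < g i (α + μ * (ξ + 1)) := fun ξ hξ =>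
        lt_of_le_of_ne (hg i _ _ (by gcongr; exact le_self_add)
          ((hle _ (Order.add_one_le_of_lt hξ)).trans_lt hαμ)) (hne ξ hξ)
      have hgrow : ∀ ξ, ξ ≤ θ i + 1 → ξ ≤ g i (α + μ * ξ) := by
        intro ξ
        induction ξ using WellFoundedLT.induction with
        | ind ξ ihξ =>
          refine fun hξ => le_of_forall_lt fun ζ hζ => ?_
          calc ζ ≤ g i (α + μ * ζ) := ihξ ζ hζ (hζ.le.trans hξ)
            _ < g i (α + μ * (ζ + 1)) := hlt ζ (hζ.trans_le hξ)
            _ ≤ g i (α + μ * ξ) := hg i _ _ (by gcongr; exact Order.add_one_le_of_lt hζ)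
              ((hle ξ hξ).trans_lt hαμ)
      exact absurd ((hgrow _ le_rfl).trans (hgθ i _ hαμ)) (not_le.2 (Order.lt_add_one_iff.2 le_rfl))
    obtain ⟨ξ, hξ, heq⟩ := hex
    have hstep : α + μ * ξ + μ = α + μ * (ξ + 1) := by rw [mul_add, mul_one, add_assoc]
    have hend : α + μ * ξ + μ ≤ α + μ * (θ i + 1) := hstep ▸ hle _ (Order.add_one_le_of_lt hξ)
    refine ⟨α + μ * ξ, hα.trans le_self_add, hend.trans_lt hαμ, fun j hj => ?_⟩
    rcases Finset.mem_insert.1 hj with rfl | hj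
    · rw [hstep, heq]
    · refine le_antisymm (hg j _ _ le_self_add (hend.trans_lt hαμ)) ?_
      calc g j (α + μ * ξ + μ) ≤ g j (α + μ * (θ i + 1)) := hg j _ _ hend hαμ
        _ = g j α := (hs j hj).symm
        _ ≤ g j (α + μ * ξ) := hg j _ _ le_self_add
          (le_self_add.trans_lt (hend.trans_lt hαμ))

/-! ### Countable subsets of `ω₁` under the continuum hypothesis -/

/-- `f` is single-valued on `w`, and its values there include all subsets in `H(κ)` of the elements
of `w`. -/
def IsEnumeration (κ : Cardinal.{u}) (f w : ZFSet.{u}) : Prop :=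
  (∀ x ∈ H κ, (∃ β ∈ w, x ⊆ β) → ∃ ξ ∈ w, ZFSet.pair ξ x ∈ f) ∧
  ∀ ξ ∈ w, ∀ x ∈ H κ, ∀ y ∈ H κ, ZFSet.pair ξ x ∈ f → ZFSet.pair ξ y ∈ f → x = y

instance {Γ : Type} (i j : Γ) : IsFirstOrder κ r (fun v => IsEnumeration κ (v i) (v j)) := by
  unfold IsEnumeration
  infer_instance

/-- There are `ℵ₁ · 2^ℵ₀` bounded subsets of `ω₁`, and `2^ℵ₀ = ℵ₁`. -/
theorem exists_isEnumeration (CH : (ℵ₁ : Cardinal.{u}) = 𝔠) (hκ : κ.IsRegular) (hκ₁ : ℵ₁ < κ) :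
    ∃ f ∈ H κ, IsEnumeration κ f (ω_ (1 : Ordinal.{u})).toZFSet := by
  let w : ZFSet.{u} := (ω_ (1 : Ordinal.{u})).toZFSet
  have hwc : w.card = ℵ₁ := by simp [w]
  have hwH : w ∈ H κ := toZFSet_mem_H hκ (by simpa using hκ₁)
  let e : Shrink.{u} w → ZFSet.{u} := fun b => (equivShrink w).symm b
  have he : ∀ b, e b ∈ w := fun b => ((equivShrink w).symm b).2
  let Q : ZFSet.{u} := ZFSet.iUnion fun b : Shrink.{u} w => (e b).powerset
  have hQ : ∀ x, x ∈ Q ↔ ∃ β ∈ w, x ⊆ β := fun x => by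
    simp only [Q, ZFSet.mem_iUnion, ZFSet.mem_powerset]
    exact ⟨fun ⟨b, h⟩ => ⟨_, he b, h⟩,
      fun ⟨β, hβ, h⟩ => ⟨equivShrink w ⟨β, hβ⟩, by simpa [e] using h⟩⟩
  have hQH : ∀ x ∈ Q, x ∈ H κ := fun x hx => by
    obtain ⟨β, hβ, h⟩ := (hQ x).1 hx
    exact mem_H_of_subset hκ (mem_H_of_mem hwH hβ) h
  have hpow : ∀ b, (e b).powerset.card ≤ ℵ₁ := fun b => by
    obtain ⟨α, hα, h⟩ := Ordinal.mem_toZFSet_iff.1 (he b)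
    rw [ZFSet.card_powerset, CH, ← Cardinal.two_power_aleph0, ← h]
    exact Cardinal.power_le_power_left two_ne_zero (card_toZFSet_le_aleph0 hα)
  have hQc : Q.card ≤ w.card := by
    have h1 := ZFSet.lift_card_iUnion_le_sum_card.{u, u}
      (f := fun b : Shrink.{u} w => (e b).powerset)
    rw [Cardinal.lift_id] at h1
    refine h1.trans ((Cardinal.sum_le_sum _ _ hpow).trans ?_)
    rw [Cardinal.sum_const', hwc]
    exact (mul_le_mul' hwc.le le_rfl).trans (Cardinal.mul_eq_self (Cardinal.aleph0_le_aleph 1)).le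
  have hQκ : Q.card < κ := hQc.trans_lt (hwc ▸ hκ₁)
  obtain ⟨j⟩ := hQc
  let q : Shrink.{u} Q → ZFSet.{u} := fun x => (equivShrink Q).symm x
  have hq : ∀ x, q x ∈ Q := fun x => ((equivShrink Q).symm x).2
  refine ⟨ZFSet.range fun x : Shrink.{u} Q => ZFSet.pair (e (j x)) (q x),
    range_mem_H hκ hQκ fun x => pair_mem_H hκ (mem_H_of_mem hwH (he _)) (hQH _ (hq x)), ?_, ?_⟩
  · intro x _ hx
    refine ⟨e (j (equivShrink Q ⟨x, (hQ x).2 hx⟩)), he _, ZFSet.mem_range.2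
      ⟨equivShrink Q ⟨x, (hQ x).2 hx⟩, ?_⟩⟩
    simp [q]
  · intro ξ _ x _ y _ h1 h2
    obtain ⟨x', h1⟩ := ZFSet.mem_range.1 h1
    obtain ⟨y', h2⟩ := ZFSet.mem_range.1 h2
    obtain ⟨h3, rfl⟩ := ZFSet.pair_inj.1 h1
    obtain ⟨h4, rfl⟩ := ZFSet.pair_inj.1 h2
    have : j x' = j y' := (equivShrink w).symm.injective (Subtype.ext (h3.trans h4.symm))
    rw [j.injective this]

/-- Under the continuum hypothesis, the countable subsets of `ω₁` in an elementary submodel belong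
to every elementary submodel of at least the same height: they occur in the `◁`-least enumeration of
the bounded subsets of `ω₁` in order type `ω₁`, and are determined by their index. -/
theorem mem_of_countable_subset_omega_one (CH : (ℵ₁ : Cardinal.{u}) = 𝔠) (hκ : κ.IsRegular)
    (hκ₁ : ℵ₁ < κ) (hr : IsWellOrder (H κ) r) {M L : ZFSet.{u}} (hM : M ∈ Sub κ r)
    (hL : L ∈ Sub κ r) (hML : height M ⊆ L) {A : ZFSet.{u}} (hAM : A ∈ M)
    (hA : A ⊆ (ω_ (1 : Ordinal.{u})).toZFSet) (hc : A.card ≤ ℵ₀) : A ∈ L := by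
  let w : ZFSet.{u} := (ω_ (1 : Ordinal.{u})).toZFSet
  have hwM : w ∈ M := omega_one_mem_sub hκ hκ₁ hM
  have hwL : w ∈ L := omega_one_mem_sub hκ hκ₁ hL
  have hAH := mem_H_of_mem_sub hM hAM
  obtain ⟨f, _, hf, hfsub⟩ := exists_canonical hr w w w (fun w _ _ f => IsEnumeration κ f w)
    (exists_isEnumeration CH hκ hκ₁)
  have hfM := hfsub M hM hwM hwM hwM
  have hfL := hfsub L hL hwL hwL hwL
  have hbdd : ∃ β ∈ w, A ⊆ β := by
    refine ⟨A.rank.toZFSet, Ordinal.toZFSet_mem_toZFSet_iff.2 ?_,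
      subset_toZFSet_rank fun a => isOrdinal_of_mem_of_subset hA⟩
    simpa using rank_lt_omega_succ (k := 0) (by simpa using hA) hc
  obtain ⟨ξ, hξM, hξ, hξA⟩ := exists_mem_of_sub₃ hM f A w
    (fun f A w ξ => ξ ∈ w ∧ ZFSet.pair ξ A ∈ f) hfM hAM hwM (by
      obtain ⟨ξ, hξ, h⟩ := hf.1 A hAH hbdd
      exact ⟨ξ, mem_H_of_mem (mem_H_of_mem_sub hM hwM) hξ, hξ, h⟩)
  have hξL : ξ ∈ L := hML (ZFSet.mem_inter.2 ⟨hξM, hξ⟩)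
  exact mem_of_sub_of_unique hL f ξ w (fun f ξ _ x => ZFSet.pair ξ x ∈ f) hfL hξL hwL hAH hξA
    fun y hy h => hf.2 ξ hξ y hy A hAH h hξA

/-! ### Chains of submodels -/

/-- `C` is a continuous increasing chain of `m`-models of length `δ` with union `N`, as in the
definition of an `(m+1)`-model, with `δ` the height of `N`. -/
structure IsModelChain (κ : Cardinal.{u}) (r : H κ → H κ → Prop) (m : ℕ) (N : ZFSet.{u})
    (δ : Ordinal.{u}) (C : Ordinal.{u} → ZFSet.{u}) : Prop where
  height_eq : height N = δ.toZFSet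
  omega0_lt : ω < δ
  isPrincipal : Ordinal.IsPrincipal (· * ·) δ
  mem_sub : ∀ α < δ, C α ∈ Sub κ r
  mem : ∀ α β, α < β → β < δ → C α ∈ C β
  subset : ∀ α β, α ≤ β → β < δ → C α ⊆ C β
  limit : ∀ α < δ, Order.IsSuccLimit α → ∀ x ∈ C α, ∃ ξ < α, x ∈ C ξ
  mem_union : ∀ α < δ, C α ∈ N
  subset_union : ∀ α < δ, C α ⊆ N
  exists_mem : ∀ x ∈ N, ∃ α < δ, x ∈ C α
  isNModel : ∀ α < δ, IsNModel κ r m (C α)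

theorem IsNModel.exists_isModelChain (hκ : κ.IsRegular) (hκ₁ : ℵ₁ < κ) {m : ℕ} {N : ZFSet.{u}}
    (hN : IsNModel κ r (m + 1) N) : ∃ δ C, IsModelChain κ r m N δ C := by
  obtain ⟨hN, C, ⟨h1, h2, h3⟩, h4, h5, h6⟩ := hN
  obtain ⟨δ, hδ, hω, hp⟩ := exists_height_eq hκ hκ₁ hN
  simp only [hδ, Ordinal.toZFSet_mem_toZFSet_iff] at h1 h2 h3 h4 h5 h6
  have hκ₀ : ℵ₀ < κ := Cardinal.aleph0_lt_aleph_one.trans hκ₁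
  refine ⟨δ, C, hδ, hω, hp, h1, fun α β h hβ => h2 α β hβ h, fun α β h hβ => ?_,
    fun α hα hlim x hx => (h3 α hα hlim x).1 hx, h4,
    fun α hα => sub_subset_of_mem_sub hκ hκ₀ hN (h1 α hα) (h4 α hα), fun x hx => (h5 x).1 hx, h6⟩
  rcases h.eq_or_lt with rfl | h
  · exact subset_rfl
  · exact sub_subset_of_mem_sub hκ hκ₀ (h1 β hβ) (h1 α (h.trans hβ)) (h2 α β hβ h)

theorem IsModelChain.exists_forall_mem {m : ℕ} {N : ZFSet.{u}} {δ : Ordinal.{u}}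
    {C : Ordinal.{u} → ZFSet.{u}} (hC : IsModelChain κ r m N δ C) (F : Finset ZFSet.{u})
    (hF : ∀ x ∈ F, x ∈ N) : ∃ α < δ, ∀ x ∈ F, x ∈ C α := by
  classical
  induction F using Finset.induction with
  | empty => exact ⟨0, Ordinal.omega0_pos.trans hC.omega0_lt, by simp⟩
  | insert a F _ ih =>
    obtain ⟨α, hα, h1⟩ := ih fun x hx => hF x (Finset.mem_insert_of_mem hx)
    obtain ⟨β, hβ, h2⟩ := hC.exists_mem a (hF a (Finset.mem_insert_self _ _))
    refine ⟨max α β, max_lt hα hβ, fun x hx => ?_⟩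
    rcases Finset.mem_insert.1 hx with rfl | hx
    · exact hC.subset _ _ (le_max_right _ _) (max_lt hα hβ) h2
    · exact hC.subset _ _ (le_max_left _ _) (max_lt hα hβ) (h1 x hx)

/-- The least strict upper bound of a set of ordinals in an elementary submodel belongs to the
submodel. -/
theorem rank_toZFSet_mem_sub {M : ZFSet.{u}} (hM : M ∈ Sub κ r) {A : ZFSet.{u}} (hAM : A ∈ M)
    (hA : ∀ a ∈ A, a.IsOrdinal) (hH : A.rank.toZFSet ∈ H κ) : A.rank.toZFSet ∈ M :=
  mem_of_sub_of_ext hM A A A (fun A _ _ y => ∃ b ∈ A, y = b ∨ y ∈ b) hAM hAM hAM hH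
    fun _ _ => mem_toZFSet_rank_iff hA

/-- A countable set `A` of ordinals in an elementary submodel has all of its initial segments in the
submodel, even if they are cut off at an ordinal `γ` outside of it: the least element of `A` that is
not below `γ` defines the same segment. -/
theorem inter_toZFSet_mem_sub (hκ : κ.IsRegular) (hκ₀ : ℵ₀ < κ) {M : ZFSet.{u}} (hM : M ∈ Sub κ r)
    {A : ZFSet.{u}} (hAM : A ∈ M) (hA : ∀ a ∈ A, a.IsOrdinal) (hc : A.card ≤ ℵ₀)
    (γ : Ordinal.{u}) : A ∩ γ.toZFSet ∈ M := by
  by_cases h : A ⊆ γ.toZFSet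
  · rwa [ZFSet.inter_eq_left_of_subset h]
  · obtain ⟨b, ⟨hbA, hbγ⟩, hmin⟩ := ZFSet.mem_wf.has_min {b | b ∈ A ∧ b ∉ γ.toZFSet} (by
      by_contra hne
      rw [Set.not_nonempty_iff_eq_empty] at hne
      exact h fun a ha => by
        by_contra hb
        exact (hne ▸ (⟨ha, hb⟩ : a ∈ {b | b ∈ A ∧ b ∉ γ.toZFSet}) : a ∈ (∅ : Set ZFSet.{u})))
    have hγb : γ.toZFSet ⊆ b :=
      (ZFSet.IsOrdinal.notMem_iff_subset (hA b hbA) (ZFSet.isOrdinal_toZFSet γ)).1 hbγ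
    have heq : A ∩ γ.toZFSet = A ∩ b := by
      ext a
      simp only [ZFSet.mem_inter]
      refine and_congr_right fun ha => ⟨fun h => hγb h, fun h => ?_⟩
      by_contra ha'
      exact hmin a ⟨ha, ha'⟩ h
    rw [heq]
    exact inter_mem_sub hκ hM hAM (subset_of_mem_sub hκ hκ₀ hM hAM hc hbA)

/-- For `α < ε` with `ε` a limit, the least strict upper bound `γ` of `A ∩ C α` belongs to `C ε`, for
every set `A` of ordinals with an upper bound in `C ε`: it is also that of `ξ ∩ C β` for some
`β < ε`, where `ξ` is the least ordinal of `C ε` with `γ ≤ ξ`. -/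
theorem IsModelChain.rank_inter_mem (hκ : κ.IsRegular) {m : ℕ} {N : ZFSet.{u}}
    {δ : Ordinal.{u}} {C : Ordinal.{u} → ZFSet.{u}} (hC : IsModelChain κ r m N δ C)
    {α ε η : Ordinal.{u}} (hαε : α < ε) (hε : ε < δ) (hlim : Order.IsSuccLimit ε)
    {A : ZFSet.{u}} (hA : A ⊆ η.toZFSet) (hη : η.toZFSet ∈ C ε) :
    (A ∩ C α).rank.toZFSet ∈ C ε := by
  set γ := (A ∩ C α).rank
  have hord : ∀ a ∈ A ∩ C α, a.IsOrdinal := fun a ha =>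
    isOrdinal_of_mem_of_subset hA (ZFSet.mem_inter.1 ha).1
  have hγη : γ ≤ η := rank_le_of_subset_toZFSet fun a ha => hA (ZFSet.mem_inter.1 ha).1
  obtain ⟨ξ, ⟨hξε, hγξ⟩, hmin⟩ := wellFounded_lt.has_min
    {ξ : Ordinal.{u} | ξ.toZFSet ∈ C ε ∧ γ ≤ ξ} ⟨η, hη, hγη⟩
  obtain ⟨β, hβ, hξβ⟩ := hC.limit ε hε hlim _ hξε
  have hmax : max α β < ε := max_lt hαε hβ
  have hCε := hC.mem_sub ε hε
  refine mem_of_sub_of_ext hCε (C (max α β)) ξ.toZFSet ξ.toZFSet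
    (fun D x _ y => ∃ b ∈ D, b ∈ x ∧ (y = b ∨ y ∈ b)) (hC.mem _ _ hmax hε) hξε hξε
    (mem_H_of_subset hκ (mem_H_of_mem_sub hCε hξε) (Ordinal.toZFSet_subset_toZFSet_iff.2 hγξ))
    fun y _ => ⟨fun hy => ?_, fun ⟨b, hb, hbξ, hyb⟩ => ?_⟩
  · obtain ⟨b, hb, hyb⟩ := (mem_toZFSet_rank_iff hord).1 hy
    exact ⟨b, hC.subset _ _ (le_max_left _ _) (hmax.trans hε) (ZFSet.mem_inter.1 hb).2,
      Ordinal.toZFSet_subset_toZFSet_iff.2 hγξ (subset_toZFSet_rank hord hb), hyb⟩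
  · obtain ⟨ζ, hζ, rfl⟩ := Ordinal.mem_toZFSet_iff.1 hbξ
    have hζγ : ζ < γ := by
      by_contra hle
      exact hmin ζ ⟨hC.subset _ _ hmax.le hε hb, not_lt.1 hle⟩ hζ
    have hbγ : ζ.toZFSet ∈ γ.toZFSet := Ordinal.toZFSet_mem_toZFSet_iff.2 hζγ
    rcases hyb with rfl | hy
    · exact hbγ
    · exact (ZFSet.isOrdinal_toZFSet γ).mem_trans hy hbγ

/-- The supremum of the successors `f b + 1` for `b ∈ S`. -/
theorem exists_forall_lt_iff (S : ZFSet.{u}) (f : ZFSet.{u} → Ordinal.{u}) :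
    ∃ o : Ordinal.{u}, ∀ ζ, ζ < o ↔ ∃ b ∈ S, ζ ≤ f b := by
  refine ⟨(ZFSet.range fun b : Shrink.{u} S => (f ((equivShrink S).symm b)).toZFSet).rank,
    fun ζ => ?_⟩
  rw [ZFSet.lt_rank_iff]
  constructor
  · rintro ⟨y, hy, h⟩
    obtain ⟨b, rfl⟩ := ZFSet.mem_range.1 hy
    exact ⟨_, ((equivShrink S).symm b).2, by simpa using h⟩
  · rintro ⟨b, hb, h⟩
    exact ⟨_, ZFSet.mem_range.2 ⟨equivShrink S ⟨b, hb⟩, rfl⟩, by simpa using h⟩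

/-- Some stretch `[α, ε]` of a chain, with `ε` a limit, adds no element of any `A i` above
`A i ∩ C α`, for finitely many sets `A i` of ordinals of order type less than `δ`. -/
theorem IsModelChain.exists_stable {ι : Type} [Fintype ι] {m : ℕ} {N : ZFSet.{u}}
    {δ : Ordinal.{u}} {C : Ordinal.{u} → ZFSet.{u}} (hC : IsModelChain κ r m N δ C)
    (A : ι → ZFSet.{u}) (hA : ∀ i, ∀ a ∈ A i, a.IsOrdinal) (θ : ι → Ordinal.{u})
    (hθ : ∀ i, θ i < δ) (f : ι → ZFSet.{u} → Ordinal.{u}) (hfθ : ∀ i, ∀ a ∈ A i, f i a < θ i)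
    (hf : ∀ i, ∀ a ∈ A i, ∀ b ∈ A i, a ∈ b → f i a < f i b) {α₀ : Ordinal.{u}} (hα₀ : α₀ < δ) :
    ∃ α ε, α₀ ≤ α ∧ α < ε ∧ ε < δ ∧ Order.IsSuccLimit ε ∧
      ∀ i, A i ∩ C ε ⊆ (A i ∩ C α).rank.toZFSet := by
  -- `A i ∩ C α` is measured by the least strict upper bound `g i α` of the values of `f i` on it.
  choose g hg using fun i α => exists_forall_lt_iff (A i ∩ C α) (f i)
  obtain ⟨α, hα, hαδ, hconst⟩ := exists_interval_const hC.isPrincipal hC.omega0_lt g θ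
    (fun i α β hαβ hβ => le_of_forall_lt fun ζ hζ => by
      obtain ⟨b, hb, h⟩ := (hg i α ζ).1 hζ
      rw [ZFSet.mem_inter] at hb
      exact (hg i β ζ).2 ⟨b, ZFSet.mem_inter.2 ⟨hb.1, hC.subset α β hαβ hβ hb.2⟩, h⟩)
    (fun i α hα => le_of_forall_lt fun ζ hζ => by
      obtain ⟨b, hb, h⟩ := (hg i α ζ).1 hζ
      exact h.trans_lt (hfθ i b (ZFSet.mem_inter.1 hb).1))
    hθ hα₀ Finset.univ ω hC.omega0_lt
  refine ⟨α, α + ω, hα, ?_, hαδ, Ordinal.isSuccLimit_add α Ordinal.isSuccLimit_omega0,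
    fun i a ha => ?_⟩
  · exact lt_add_of_pos_right α Ordinal.omega0_pos
  · have h1 : f i a < g i α := by
      rw [hconst i (Finset.mem_univ i)]
      exact (hg i _ _).2 ⟨a, ha, le_rfl⟩
    obtain ⟨b, hb, hab⟩ := (hg i α _).1 h1
    have haA := (ZFSet.mem_inter.1 ha).1
    have hbA := (ZFSet.mem_inter.1 hb).1
    refine (mem_toZFSet_rank_iff fun c hc => hA i c (ZFSet.mem_inter.1 hc).1).2 ⟨b, hb, ?_⟩
    rcases (hA i a haA).mem_trichotomous (hA i b hbA) with h | h | h
    · exact Or.inr h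
    · exact Or.inl h
    · exact absurd (hf i b hbA a haA h) (not_lt.2 hab)

/-! ### The splitting theorem -/

theorem subset_of_mem_omega_one_of_mem_sub (hκ : κ.IsRegular) (hκ₁ : ℵ₁ < κ) {M d : ZFSet.{u}}
    (hM : M ∈ Sub κ r) (hdM : d ∈ M) (hd : d ∈ (ω_ (1 : Ordinal.{u})).toZFSet) : d ⊆ M := by
  obtain ⟨β, hβ, rfl⟩ := Ordinal.mem_toZFSet_iff.1 hd
  exact subset_of_mem_sub hκ (Cardinal.aleph0_lt_aleph_one.trans hκ₁) hM hdM
    (card_toZFSet_le_aleph0 hβ)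

/-- Given countable `A i ⊆ ω_{l+1}` in `M i` and an `(l+1)`-model `N`, some elementary submodel
`L ∈ N` that contains prescribed elements of `N` has `A i ∩ L` in both `M i` and `L`. -/
theorem exists_sub_inter_mem (CH : (ℵ₁ : Cardinal.{u}) = 𝔠) (hκ : κ.IsRegular)
    (hr : IsWellOrder (H κ) r) {ι : Type} [Fintype ι] (M : ι → ZFSet.{u})
    (hM : ∀ i, M i ∈ Sub κ r) (d : ZFSet.{u}) (hd : d ∈ (ω_ (1 : Ordinal.{u})).toZFSet)
    (hMd : ∀ i, height (M i) ⊆ d) (l : ℕ) (hl : ℵ_ ((l + 1 : ℕ) : Ordinal.{u}) < κ)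
    (A : ι → ZFSet.{u}) (hAM : ∀ i, A i ∈ M i)
    (hA : ∀ i, A i ⊆ (ω_ ((l + 1 : ℕ) : Ordinal.{u})).toZFSet) (hAc : ∀ i, (A i).card ≤ ℵ₀)
    (N : ZFSet.{u}) (hN : IsNModel κ r (l + 1) N) (hdN : d ∈ N) (F : Finset ZFSet.{u})
    (hF : ∀ x ∈ F, x ∈ N) :
    ∃ L ∈ N, L ∈ Sub κ r ∧ d ∈ L ∧ (∀ x ∈ F, x ∈ L) ∧ ∀ i, A i ∩ L ∈ M i ∧ A i ∩ L ∈ L := by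
  classical
  have hκ₁ : ℵ₁ < κ := lt_of_le_of_lt (Cardinal.aleph_le_aleph.2 (by simp)) hl
  have hκ₀ : ℵ₀ < κ := Cardinal.aleph0_lt_aleph_one.trans hκ₁
  induction l generalizing A N F with
  | zero =>
    obtain ⟨δ, C, hC⟩ := hN.exists_isModelChain hκ hκ₁
    obtain ⟨α, hα, hαF⟩ := hC.exists_forall_mem (insert d F) (by simpa using ⟨hdN, hF⟩)
    simp only [Finset.mem_insert, forall_eq_or_imp] at hαF
    have hL := hC.mem_sub α hα
    refine ⟨C α, hC.mem_union α hα, hL, hαF.1, hαF.2, fun i => ?_⟩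
    have hAL : A i ∈ C α := mem_of_countable_subset_omega_one CH hκ hκ₁ hr (hM i) hL
      (fun x hx => subset_of_mem_omega_one_of_mem_sub hκ hκ₁ hL hαF.1 hd (hMd i hx)) (hAM i)
      (by simpa using hA i) (hAc i)
    rw [ZFSet.inter_eq_left_of_subset (subset_of_mem_sub hκ hκ₀ hL hAL (hAc i))]
    exact ⟨hAM i, hAL⟩
  | succ l ih =>
    have hl' : ℵ_ ((l + 1 : ℕ) : Ordinal.{u}) < κ :=
      lt_of_le_of_lt (Cardinal.aleph_le_aleph.2 (by simp)) hl
    obtain ⟨δ, C, hC⟩ := hN.exists_isModelChain hκ hκ₁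
    have hord : ∀ i, ∀ a ∈ A i, a.IsOrdinal := fun i a => isOrdinal_of_mem_of_subset (hA i)
    -- A stretch of the chain along which the traces on the `A i` stabilize.
    choose θ hθ₁ hθM f hfθ hf using fun i =>
      exists_strictMono_of_mem_sub hκ hκ₁ (hM i) (hAM i) (hord i) (hAc i)
    have hθ : ∀ i, θ i < δ := fun i => by
      have h1 := hMd i (toZFSet_mem_height.2 ⟨hθM i, hθ₁ i⟩)
      have h2 : d ∈ δ.toZFSet := hC.height_eq ▸ ZFSet.mem_inter.2 ⟨hdN, hd⟩
      exact Ordinal.toZFSet_mem_toZFSet_iff.1 ((ZFSet.isOrdinal_toZFSet δ).mem_trans h1 h2)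
    obtain ⟨α₀, hα₀, hα₀F⟩ := hC.exists_forall_mem (insert d F) (by simpa using ⟨hdN, hF⟩)
    obtain ⟨α, ε, hα, hαε, hε, hlim, hstable⟩ :=
      hC.exists_stable A hord θ hθ f hfθ hf hα₀
    have hα₀F' : ∀ x ∈ insert d F, x ∈ C ε := fun x hx =>
      hC.subset _ _ (hα.trans hαε.le) hε (hα₀F x hx)
    simp only [Finset.mem_insert, forall_eq_or_imp] at hα₀F'
    have hCε := hC.mem_sub ε hε
    -- The bound `γ i` of the trace belongs to both `M i` and `C ε`.
    let γ : ι → Ordinal.{u} := fun i => (A i ∩ C α).rank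
    have hγ : ∀ i, γ i < ω_ ((l + 1 + 1 : ℕ) : Ordinal.{u}) := fun i =>
      rank_lt_omega_succ (fun a ha => hA i (ZFSet.mem_inter.1 ha).1)
        ((ZFSet.card_mono fun a ha => (ZFSet.mem_inter.1 ha).1).trans (hAc i))
    have hγH : ∀ i, (γ i).toZFSet ∈ H κ := fun i =>
      mem_H_of_mem (omega_mem_H hκ hl) (Ordinal.toZFSet_mem_toZFSet_iff.2 (hγ i))
    have hγε : ∀ i, (γ i).toZFSet ∈ C ε := fun i =>
      hC.rank_inter_mem hκ hαε hε hlim (hA i) (omega_mem_sub hκ hl hCε)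
    have hSM : ∀ i, A i ∩ (γ i).toZFSet ∈ M i := fun i =>
      inter_toZFSet_mem_sub hκ hκ₀ (hM i) (hAM i) (hord i) (hAc i) (γ i)
    have hγM : ∀ i, (γ i).toZFSet ∈ M i := fun i => by
      have h1 : (A i ∩ (γ i).toZFSet).rank = γ i := by
        refine le_antisymm (rank_le_of_subset_toZFSet fun a ha => (ZFSet.mem_inter.1 ha).2)
          (ZFSet.rank_mono fun a ha => ZFSet.mem_inter.2 ⟨(ZFSet.mem_inter.1 ha).1, ?_⟩)
        exact subset_toZFSet_rank (fun a ha => hord i a (ZFSet.mem_inter.1 ha).1) ha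
      have h2 := rank_toZFSet_mem_sub (hM i) (hSM i)
        (fun a ha => hord i a (ZFSet.mem_inter.1 ha).1) (by rw [h1]; exact hγH i)
      rwa [h1] at h2
    -- Transfer the traces to `ω_{l+1}` along the `◁`-least injection of `γ i`.
    let w : ZFSet.{u} := (ω_ ((l + 1 : ℕ) : Ordinal.{u})).toZFSet
    have hwH : w ∈ H κ := omega_mem_H hκ hl'
    have hw : ∀ K ∈ Sub κ r, w ∈ K := fun K hK => omega_mem_sub hκ hl' hK
    have hγw : ∀ i, (γ i).toZFSet.card ≤ w.card := fun i => by
      have h1 := hγ i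
      rw [← Cardinal.ord_aleph, Cardinal.lt_ord, Nat.cast_add_one (l + 1), ← Cardinal.succ_aleph,
        Order.lt_succ_iff] at h1
      simpa [w] using h1
    choose e _ he hesub using fun i => exists_canonical hr (γ i).toZFSet w w
      (fun g w _ e => IsInjection e g w) (exists_isInjection hκ (hγH i) hwH (hγw i))
    let B : ι → ZFSet.{u} := fun i =>
      ZFSet.sep (fun y => ∃ a ∈ A i ∩ (γ i).toZFSet, ZFSet.pair a y ∈ e i) w
    have hB : ∀ i y, y ∈ B i ↔ y ∈ w ∧ ∃ a ∈ A i ∩ (γ i).toZFSet, ZFSet.pair a y ∈ e i :=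
      fun i y => ZFSet.mem_sep
    have heM : ∀ i, e i ∈ M i := fun i =>
      hesub i _ (hM i) (hγM i) (hw _ (hM i)) (hw _ (hM i))
    have hBM : ∀ i, B i ∈ M i := fun i =>
      mem_of_sub_of_ext (hM i) _ _ _ (fun S e w y => y ∈ w ∧ ∃ a ∈ S, ZFSet.pair a y ∈ e)
        (hSM i) (heM i) (hw _ (hM i))
        (mem_H_of_subset hκ hwH ZFSet.sep_subset) fun y _ => hB i y
    have hBc : ∀ i, (B i).card ≤ ℵ₀ := fun i => by
      refine (card_le_of_forall_exists (y := A i ∩ (γ i).toZFSet)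
        (fun y a => ZFSet.pair a y ∈ e i) (fun y hy => ((hB i y).1 hy).2)
        fun y hy y' hy' a ha h h' => ?_).trans
        ((ZFSet.card_mono fun a ha => (ZFSet.mem_inter.1 ha).1).trans (hAc i))
      exact (he i).2.2 a (ZFSet.mem_inter.1 ha).2 y ((hB i y).1 hy).1 y' ((hB i y').1 hy').1 h h'
    obtain ⟨L, hLε, hL, hdL, hFL, hBL⟩ := ih hl' B hBM (fun i => ZFSet.sep_subset) hBc (C ε)
      (hC.isNModel ε hε) hα₀F'.1 (F ∪ Finset.univ.image fun i => (γ i).toZFSet) (by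
        intro x hx
        rcases Finset.mem_union.1 hx with hx | hx
        · exact hα₀F'.2 x hx
        · obtain ⟨i, -, rfl⟩ := Finset.mem_image.1 hx
          exact hγε i)
    refine ⟨L, hC.subset_union ε hε hLε, hL, hdL,
      fun x hx => hFL x (Finset.mem_union_left _ hx), fun i => ?_⟩
    have hγL : (γ i).toZFSet ∈ L :=
      hFL _ (Finset.mem_union_right _ (Finset.mem_image_of_mem _ (Finset.mem_univ i)))
    have heL : e i ∈ L := hesub i L hL hγL (hw L hL) (hw L hL)
    have hmem : ∀ a, a ∈ A i ∩ L ↔ a ∈ (γ i).toZFSet ∧ ∃ y ∈ B i ∩ L, ZFSet.pair a y ∈ e i := by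
      intro a
      constructor
      · intro ha
        obtain ⟨haA, haL⟩ := ZFSet.mem_inter.1 ha
        have haγ : a ∈ (γ i).toZFSet := hstable i (ZFSet.mem_inter.2
          ⟨haA, sub_subset_of_mem_sub hκ hκ₀ hCε hL hLε haL⟩)
        obtain ⟨y, hy, hay⟩ := (he i).1 a haγ
        refine ⟨haγ, y, ZFSet.mem_inter.2
          ⟨(hB i y).2 ⟨hy, a, ZFSet.mem_inter.2 ⟨haA, haγ⟩, hay⟩, ?_⟩, hay⟩
        exact mem_of_sub_of_unique hL (e i) a w (fun e a w y => y ∈ w ∧ ZFSet.pair a y ∈ e)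
          heL haL (hw L hL) (mem_H_of_mem hwH hy) ⟨hy, hay⟩
          fun y' _ h => (he i).2.2 a haγ y' h.1 y hy h.2 hay
      · rintro ⟨haγ, y, hy, hay⟩
        obtain ⟨hyB, hyL⟩ := ZFSet.mem_inter.1 hy
        obtain ⟨hyw, a', ha', ha'y⟩ := (hB i y).1 hyB
        obtain ⟨ha'A, ha'γ⟩ := ZFSet.mem_inter.1 ha'
        obtain rfl : a = a' := (he i).2.1 a haγ a' ha'γ y hyw hay ha'y
        refine ZFSet.mem_inter.2 ⟨ha'A, ?_⟩
        exact mem_of_sub_of_unique hL (e i) y (γ i).toZFSet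
          (fun e y g a => a ∈ g ∧ ZFSet.pair a y ∈ e) heL hyL hγL
          (mem_H_of_mem (hγH i) haγ) ⟨haγ, hay⟩
          fun a' _ h => (he i).2.1 a' h.1 a haγ y hyw h.2 hay
    have hH : A i ∩ L ∈ H κ := mem_H_of_subset hκ (hγH i) fun a ha => ((hmem a).1 ha).1
    have hboth : ∀ K ∈ Sub κ r, (γ i).toZFSet ∈ K → e i ∈ K → B i ∩ L ∈ K → A i ∩ L ∈ K :=
      fun K hK h1 h2 h3 => mem_of_sub_of_ext hK _ _ _
        (fun g D e a => a ∈ g ∧ ∃ y ∈ D, ZFSet.pair a y ∈ e) h1 h3 h2 hH fun a _ => hmem a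
    exact ⟨hboth _ (hM i) (hγM i) (heM i) (hBL i).1, hboth L hL hγL heL (hBL i).2⟩

end CountableSubmodels


theorem mainTheorem4
    (CH : (ℵ₁ : Cardinal.{u}) = 𝔠)
    (l n : ℕ) (hl : 0 < l)
    (κ : Cardinal.{u}) (hκ : κ.IsRegular) (hlκ : ℵ_ (l : Ordinal.{u}) < κ)
    (r : CountableSubmodels.H κ → CountableSubmodels.H κ → Prop)
    (hr : IsWellOrder (CountableSubmodels.H κ) r)
    (M : Fin (n + 1) → ZFSet.{u}) (hM : CountableSubmodels.IsDeltaIncreasing κ r M)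
    (A : Fin (n + 1) → ZFSet.{u})
    (hAM : ∀ i, A i ∈ M i)
    (hAω : ∀ i, A i ⊆ (ω_ (l : Ordinal.{u})).toZFSet)
    (hAc : ∀ i, (A i).card ≤ ℵ₀)
    (N : ZFSet.{u}) (hN : CountableSubmodels.IsNModel κ r l N)
    (hMN : CountableSubmodels.height (M (Fin.last n)) ∈ CountableSubmodels.height N)
    (X : ZFSet.{u}) (hX : X ∈ N) :
    ∃ L ∈ N, ∃ A₀ A₁ : Fin (n + 1) → ZFSet.{u},
      (L ∈ CountableSubmodels.Sub κ r ∧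
        CountableSubmodels.height (M (Fin.last n)) ∈ CountableSubmodels.height L ∧ X ∈ L) ∧
      ∀ i,
        (({A₀ i, A₁ i} : ZFSet.{u}) ∈ M i ∧ A₀ i ∩ A₁ i = ∅ ∧ A₀ i ∪ A₁ i = A i) ∧
        (A₀ i ∈ L ∧ A₁ i ∩ L = ∅) := by
  obtain ⟨l, rfl⟩ := Nat.exists_eq_succ_of_ne_zero hl.ne'
  obtain ⟨hM, hinc⟩ := hM
  have hmono : Monotone fun i => CountableSubmodels.height (M i) := Fin.monotone_iff_le_succ.2 hinc
  obtain ⟨hdN, hd⟩ := ZFSet.mem_inter.1 hMN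
  obtain ⟨L, hLN, hL, hdL, hXL, hA⟩ := CountableSubmodels.exists_sub_inter_mem CH hκ hr M hM
    (CountableSubmodels.height (M (Fin.last n))) hd (fun i => hmono (Fin.le_last i)) l hlκ A hAM
    hAω hAc N hN hdN {X} (by simpa using hX)
  refine ⟨L, hLN, fun i => A i ∩ L, fun i => A i \ L,
    ⟨hL, ZFSet.mem_inter.2 ⟨hdL, hd⟩, hXL X (by simp)⟩, fun i => ⟨⟨?_, ?_, ?_⟩, (hA i).2, ?_⟩⟩
  · have hdiff : A i \ L = A i \ (A i ∩ L) := by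
      ext a
      simp only [ZFSet.mem_sdiff, ZFSet.mem_inter]
      tauto
    refine CountableSubmodels.pairSet_mem_sub hκ (hM i) (hA i).1 ?_
    beta_reduce
    rw [hdiff]
    exact CountableSubmodels.sdiff_mem_sub hκ (hM i) (hAM i) (hA i).1
  all_goals
    ext a
    simp only [ZFSet.mem_sdiff, ZFSet.mem_inter, ZFSet.mem_union, ZFSet.notMem_empty]
    tauto
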